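/- Let $0\le p<1$ and let $\Pi$ be a random subset of $\mathbf Z_+\times\mathbf Z_+$ to which each point belongs with probability $p$, independently of all other points. The height function $h_t(x)\in\mathbf Z_+\cup\{-\infty\}$ ($x,t\in\mathbf Z_+$) of oriented digital boiling (ODB) with corner initialization is defined by $h_0(0)=0$, $h_0(x)=-\infty$ for $x\neq 0$, and, with the convention $h_t(-1)=-\infty$: if $h_t(x-1)>h_t(x)$, then $h_{t+1}(x)=h_t(x-1)$; otherwise $h_{t+1}(x)=h_t(x)+1$ if $(x,t)\in\Pi$ and $h_{t+1}(x)=h_t(x)$ if $(x,t)\notin\Pi$. Let $0\le x\le t$ and $h\ge 0$ be integers and put $m=t-x$, $n=x+1$, $r=p/(1-p)\ge 0$, $$\varphi_+(z)=(1+z)^n,\qquad \varphi_-(z)=(1-r/z)^{-m},\qquad \varphi(z)=\varphi_+(z)\varphi_-(z)=(1+z)^n(1-r/z)^{-m}.$$ For a function $f$ write $f_k=\frac1{2\pi i}\oint f(z)\,z^{-k-1}\,dz$ $(k\in\mathbf Z)$, the integral being over a positively oriented circle subject to the conditions below (the centre need not be the origin). (a) If the circle used for $\varphi_k$ has $0$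 and $r$ in its interior, then $$\mathrm{Prob}\,(h_t(x)\le h)=(1-p)^{mn}\,D_h(\varphi),\qquad D_h(\varphi)=\det(\varphi_{i-j})_{i,j=0,\dots,h-1}.$$ (b) If the circle used for $(\varphi_- /\varphi_+)_k$ has $0$ and $r$ in its interior and $-1$ in its exterior, and the circle used for $(\varphi_+/\varphi_-)_k$ has $0$ in its interior, then for all integers $j,k\ge 0$ the series $$K_h(j,k)=\sum_{l=0}^\infty(\varphi_- /\varphi_+)_{h+j+l+1}\,(\varphi_+/\varphi_-)_{-h-k-l-1}$$ converges, and $$\mathrm{Prob}\,(h_t(x)\le h)=\det(I-K_h).$$ Here the Fredholm determinant of the infinite matrix $K_h=(K_h(j,k))_{j,k\ge 0}$ is given by the Fredholm expansion $\det(I-K_h)=\sum_{S}(-1)^{|S|}\det\big(K_h(j,k)\big)_{j,k\in S}$ over the finite sets $S\subset\mathbf Z_+$ (equivalently $\sum_{s\ge0}\frac{(-1)^s}{s!}\sum_{j_1,\dots,j_s\ge 0}\det(K_h(j_a,j_b))_{a,b=1}^{s}$), which converges absolutely. -/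

import Mathlib

open MeasureTheory ProbabilityTheory

noncomputable section

namespace ODB

open Classical in
/-- The height function `h_t(x)` of oriented digital boiling, driven by a set `marks ⊆ ℤ₊ × ℤ₊` of
marked space-time points `(x, t)`; `⊥` stands for `-∞`.
Corner initialization: `h_0(0) = 0` and `h_0(x) = -∞` for `x ≠ 0`.
If `h_t(x-1) > h_t(x)` then `h_{t+1}(x) = h_t(x-1)`; otherwise `h_{t+1}(x)` is `h_t(x) + 1` when
`(x, t)` is marked and `h_t(x)` when it is not. The convention is `h_t(-1) = -∞`. -/
def height (marks : Set (ℕ × ℕ)) : ℕ → ℕ → WithBot ℕ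
  | 0, x => if x = 0 then 0 else ⊥
  | t + 1, x =>
    let left : WithBot ℕ := if x = 0 then ⊥ else height marks t (x - 1)
    if height marks t x < left then left
    else if (x, t) ∈ marks then height marks t x + 1
    else height marks t x

/-- `marked` is the random set of marked space-time points: each space-time point is marked with
probability `p`, independently of all the others. Here `marked s` is the event that the
space-time point `s` is marked. -/
structure IsMarking {Ω : Type*} [MeasurableSpace Ω] (P : Measure Ω) (p : ℝ)
    (marked : ℕ × ℕ → Set Ω) : Prop where
  measurableSet : ∀ s, MeasurableSet (marked s)
  indep : iIndepSet marked P
  prob : ∀ s, P (marked s) = ENNReal.ofReal p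

/-- The distribution function `Prob(h_t(x) ≤ h)` of the height at site `x` and time `t`. -/
def heightCDF {Ω : Type*} [MeasurableSpace Ω] (P : Measure Ω) (marked : ℕ × ℕ → Set Ω)
    (t x h : ℕ) : ℝ :=
  P.real {ω | height {s | ω ∈ marked s} t x ≤ (h : WithBot ℕ)}

/-- `φ₊(z) = (1 + z)^n`. -/
def phiPlus (n : ℕ) (z : ℂ) : ℂ := (1 + z) ^ n

/-- `φ₋(z) = (1 - r / z)^(-m)`. -/
def phiMinus (m : ℕ) (r : ℝ) (z : ℂ) : ℂ := ((1 - (r : ℂ) / z) ^ m)⁻¹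

/-- The symbol `φ(z) = (1 + z)^n (1 - r / z)^(-m)`. -/
def symbol (m n : ℕ) (r : ℝ) (z : ℂ) : ℂ := phiPlus n z * phiMinus m r z

/-- The `k`-th Fourier (Laurent) coefficient of `f` computed on the positively oriented circle
`|z - c| = R`, that is `(2πi)⁻¹ ∮ f(z) z^(-k-1) dz`. -/
def fourierCoeffOn (c : ℂ) (R : ℝ) (f : ℂ → ℂ) (k : ℤ) : ℂ :=
  (2 * Real.pi * Complex.I)⁻¹ * ∮ z in C(c, R), f z * z ^ (-k - 1)

/-- The Toeplitz determinant `D_h = det (a_{i-j})_{i,j = 0, …, h-1}`. -/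
def toeplitzDet (a : ℤ → ℂ) (h : ℕ) : ℂ :=
  (Matrix.of fun i j : Fin h => a ((i : ℤ) - (j : ℤ))).det

/-- The terms `a_{h+j+l+1} b_{-h-k-l-1}`, `l = 0, 1, …`, of the entry `K_h(j,k)`. -/
def kernelTerm (a b : ℤ → ℂ) (h j k l : ℕ) : ℂ :=
  a ((h : ℤ) + j + l + 1) * b (-(h : ℤ) - k - l - 1)

/-- The infinite matrix `K_h(j,k) = ∑_{l ≥ 0} a_{h+j+l+1} b_{-h-k-l-1}`. -/
def kernel (a b : ℤ → ℂ) (h j k : ℕ) : ℂ := ∑' l : ℕ, kernelTerm a b h j k l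

/-- `det (I - K) = d` for an infinite matrix `K`, in the sense of the Fredholm expansion
`∑_s (-1)^s / s! ∑_{j_1, …, j_s} det (K(j_a, j_b))`, required to converge absolutely. As a minor is
symmetric in its indices and vanishes when two of them coincide, the expansion is written as a
sum over the finite sets `S = {j_1, …, j_s}` of indices. -/
def HasFredholmDet (K : ℕ → ℕ → ℂ) (d : ℂ) : Prop :=
  HasSum (fun S : Finset ℕ => (-1) ^ S.card * (Matrix.of fun i j : S => K i j).det) d

end ODB

end

/-!
The height process is read along the rows `t - x = i`: with `g_i(x) = h_{i+x}(x)` the dynamics is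
`g_{i+1}(x) = max (g_{i+1}(x-1), g_i(x) + ε)`, where `ε` is the indicator of a mark, so that every
site makes a free Bernoulli step and is then pushed by its left neighbour (`height_eq_rowHeight`).

*The joint law of a row.* For monotone bounds `a` the pushing is invisible, and the joint
distribution function `U_i(a) = Prob (∀ x < n, g_i(x) ≤ a_x)` satisfies the recursion of `n`
independent Bernoulli walks (`rowCDF_succ`); the arguments it produces outside the monotone region
are governed by the boundary condition `U(…, b, b-1, …) = U(…, b-1, b-1, …)`, which holds since
`g_i` is monotone in `x`. The determinant with entries
`[z^(a_x)] (1 - p + p z)^i (1 - z)^(x-y-1) z^(y-x)` has the same recursion by multilinearity, the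
same boundary condition because then two rows of a difference coincide, and the same initial value
(`rowCDF_eq_rowDet`). For `a` constant equal to `h`, row and column operations turn it into
`(1-p)^(mn)` times the Toeplitz determinant of size `n` of the power series
`(1 + r u)^m (1 - u)^(-n)` (`rowDet_const`).

*The Toeplitz determinant of size `h`.* Read from its top coefficient, `φ` is up to alternating
signs the inverse of that power series, and Jacobi's identity for complementary minors, applied to the
triangular Toeplitz matrix of a power series, exchanges the sizes `n` and `h`
(`det_toeplitz_dual`, `toeplitzDet_eq_det_dualSeries`, `heightCDF_eq_toeplitzDet`).

*The Fredholm determinant.* As `φ₊/φ₋` is a Laurent polynomial with lowest power `z^(-m)`, the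
matrix `K_h` has only `m` nonzero columns and its Fredholm expansion is that of a finite
determinant (`hasFredholmDet_of_columns_eq_zero`). The Borodin–Okounkov identity is then an identity
between complementary minors of Toeplitz matrices of size `h + m`, and has the form
`D_{h+m}(φ) det (1 - K_h) = D_h(φ)` (`toeplitzDet_mul_det_one_sub_kernel`). The constant needs no
computation: heights in row `m` are at most `m`, so the formula by Toeplitz determinants gives
`(1-p)^(mn) D_{h+m}(φ) = 1`.

The contour enters only through a few facts on coefficients: `φ₋` has no coefficient of positive
index, `1/φ₊` has none of negative index, and multiplication of functions by Laurent polynomials is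
convolution of coefficients.
-/

noncomputable section

namespace ODB

/-! ### The heights along the rows `t - x = i` -/

open Classical in
/-- The indicator of the mark that acts at site `x` in the step from row `i` to row `i + 1`. -/
def rowMark (s : Set (ℕ × ℕ)) (i x : ℕ) : ℕ := if (x, i + x) ∈ s then 1 else 0

/-- The height `h_{i+x}(x)`, as a process in the row index `i`: in each step every site makes its
own jump by `0` or `1`, and is then pushed up to the new height of its left neighbour. -/
def rowHeight (s : Set (ℕ × ℕ)) : ℕ → ℕ → ℕ
  | 0, _ => 0
  | i + 1, 0 => rowHeight s i 0 + rowMark s i 0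
  | i + 1, x + 1 => max (rowHeight s (i + 1) x) (rowHeight s i (x + 1) + rowMark s i (x + 1))
termination_by i x => (i, x)

lemma rowMark_le_one (s : Set (ℕ × ℕ)) (i x : ℕ) : rowMark s i x ≤ 1 := by
  unfold rowMark; split_ifs <;> simp

lemma height_eq_rowHeight (s : Set (ℕ × ℕ)) (t x : ℕ) :
    height s t x = if x ≤ t then ((rowHeight s (t - x) x : ℕ) : WithBot ℕ) else ⊥ := by
  induction t generalizing x with
  | zero =>
    rcases x with _ | x
    · simp [height, rowHeight]
    · simp [height]
  | succ t ih =>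
    rcases x with _ | x
    · simp only [height, ih, if_true, Nat.zero_le, Nat.sub_zero, not_lt_bot, if_false]
      by_cases hm : (0, t) ∈ s <;> simp [rowHeight, rowMark, hm]
    · simp only [height, ih, Nat.add_sub_cancel, Nat.add_sub_add_right, Nat.succ_ne_zero, if_false]
      by_cases h1 : x + 1 ≤ t
      · obtain ⟨i, rfl⟩ := Nat.exists_eq_add_of_le h1
        have e1 : x + 1 + i - (x + 1) = i := by omega
        have e2 : x + 1 + i - x = i + 1 := by omega
        have e3 : x + 1 + i = i + (x + 1) := by omega
        have h2 : x ≤ x + 1 + i := by omega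
        have h3 : x + 1 ≤ x + 1 + i + 1 := by omega
        simp only [e1, e2, h2, h3, if_true, Nat.le_add_right, rowHeight]
        have hcast : ((rowHeight s i (x + 1) : ℕ) : WithBot ℕ) < (rowHeight s (i + 1) x : ℕ) ↔
            rowHeight s i (x + 1) < rowHeight s (i + 1) x := WithBot.coe_lt_coe
        have hle := rowMark_le_one s i (x + 1)
        by_cases hlt : rowHeight s i (x + 1) < rowHeight s (i + 1) x
        · rw [if_pos (hcast.2 hlt), max_eq_left (by omega)]
        · rw [if_neg (mt hcast.1 hlt), max_eq_right (by omega)]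
          by_cases hm : (x + 1, i + (x + 1)) ∈ s
          · simp [rowMark, hm, e3]
          · simp [rowMark, hm, e3]
      · by_cases h2 : x = t
        · subst h2
          simp [rowHeight]
        · have h3 : ¬ x ≤ t := by omega
          have h4 : ¬ x + 1 ≤ t + 1 := by omega
          simp [h1, h3]

lemma rowHeight_le_succ (s : Set (ℕ × ℕ)) (i x : ℕ) :
    rowHeight s i x ≤ rowHeight s i (x + 1) := by
  rcases i with _ | i
  · simp [rowHeight]
  · rw [rowHeight.eq_def s (i + 1) (x + 1)]
    exact le_max_left _ _

lemma rowHeight_mono (s : Set (ℕ × ℕ)) (i : ℕ) : Monotone (rowHeight s i) :=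
  monotone_nat_of_le_succ (rowHeight_le_succ s i)

lemma add_rowMark_le_rowHeight (s : Set (ℕ × ℕ)) (i x : ℕ) :
    rowHeight s i x + rowMark s i x ≤ rowHeight s (i + 1) x := by
  rcases x with _ | x
  · rw [rowHeight.eq_def s (i + 1) 0]
  · rw [rowHeight.eq_def s (i + 1) (x + 1)]
    exact le_max_right _ _

/-- The height never exceeds the number of steps. -/
lemma rowHeight_le (s : Set (ℕ × ℕ)) (i x : ℕ) : rowHeight s i x ≤ i := by
  induction i generalizing x with
  | zero => simp [rowHeight]
  | succ i ih =>
    induction x with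
    | zero =>
      rw [rowHeight]
      have := ih 0; have := rowMark_le_one s i 0; omega
    | succ x ihx =>
      rw [rowHeight]
      have := ih (x + 1); have := rowMark_le_one s i (x + 1); omega

/-- Under monotone bounds the pushing can be ignored in the last step. -/
lemma forall_rowHeight_succ_le_iff (s : Set (ℕ × ℕ)) (i : ℕ) {n : ℕ} {a : Fin n → ℤ}
    (ha : Monotone a) :
    (∀ x : Fin n, (rowHeight s (i + 1) x : ℤ) ≤ a x) ↔
      ∀ x : Fin n, (rowHeight s i x : ℤ) + rowMark s i x ≤ a x := by
  constructor
  · intro h x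
    have := add_rowMark_le_rowHeight s i x
    have := h x
    omega
  · rintro h ⟨x, hx⟩
    induction x with
    | zero =>
      simp only [rowHeight]
      exact_mod_cast h ⟨0, hx⟩
    | succ x ih =>
      have h1 := ih (by omega)
      have h2 := ha (show (⟨x, by omega⟩ : Fin n) ≤ ⟨x + 1, hx⟩ by simp)
      have h3 := h ⟨x + 1, hx⟩
      simp only [rowHeight] at h1 h3 ⊢
      push_cast
      exact max_le (h1.trans h2) h3

lemma measurable_rowHeight {Ω : Type*} [MeasurableSpace Ω] {marked : ℕ × ℕ → Set Ω} (i x : ℕ)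
    (hm : ∀ s : ℕ × ℕ, s.2 < s.1 + i → MeasurableSet (marked s)) :
    Measurable fun ω => rowHeight {s | ω ∈ marked s} i x := by
  have hmark : ∀ i' < i, ∀ x, Measurable fun ω => rowMark {s | ω ∈ marked s} i' x := by
    intro i' hi x
    unfold rowMark
    exact Measurable.ite (hm _ (by simp; omega)) measurable_const measurable_const
  induction i generalizing x with
  | zero => simp only [rowHeight]; exact measurable_const
  | succ i ih =>
    have ih' := fun x => ih x (fun s hs => hm s (by omega)) (fun i' hi => hmark i' (by omega))
    induction x with
    | zero =>
      simp only [rowHeight]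
      exact (ih' 0).add (hmark i (by omega) 0)
    | succ x ihx =>
      simp only [rowHeight]
      exact ihx.max ((ih' _).add (hmark i (by omega) _))

/-! ### The joint distribution function of a row -/

section

variable {Ω : Type*} [MeasurableSpace Ω] (P : Measure Ω) (marked : ℕ × ℕ → Set Ω)

/-- The joint distribution function of the first `n` heights in row `i`. -/
def rowCDF (i n : ℕ) (a : Fin n → ℤ) : ℝ :=
  P.real {ω | ∀ x : Fin n, (rowHeight {s | ω ∈ marked s} i x : ℤ) ≤ a x}

lemma rowCDF_congr {i n : ℕ} {a b : Fin n → ℤ}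
    (h : ∀ s, (∀ x : Fin n, (rowHeight s i x : ℤ) ≤ a x) ↔
      ∀ x : Fin n, (rowHeight s i x : ℤ) ≤ b x) :
    rowCDF P marked i n a = rowCDF P marked i n b := by
  unfold rowCDF
  simp only [h]

variable {P marked} {p : ℝ}

/-- Independence of the marks acting on row `i` from the heights in row `i`. -/
lemma measure_rowHeight_inter_marks [IsProbabilityMeasure P] (hp0 : 0 ≤ p)
    (hmarked : IsMarking P p marked) (i n : ℕ) (a : Fin n → ℤ) (e : Finset (Fin n)) :
    P.real ({ω | ∀ x : Fin n, (rowHeight {s | ω ∈ marked s} i x : ℤ) ≤ a x} ∩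
        {ω | ∀ x : Fin n, x ∈ e ↔ ω ∈ marked (x, i + x)}) =
      rowCDF P marked i n a * ∏ x, (if x ∈ e then p else 1 - p) := by
  classical
  set S : Set (ℕ × ℕ) := {s | s.2 < s.1 + i} with hS
  -- `B s` is what the condition prescribes for the point `s`.
  set B : ℕ × ℕ → Set Ω := fun s =>
    if ∃ x : Fin n, x ∈ e ∧ s = (↑x, i + ↑x) then marked s else (marked s)ᶜ with hB
  have hBx : ∀ x : Fin n, B (x, i + x) =
      if x ∈ e then marked (x, i + x) else (marked (x, i + x))ᶜ := by
    intro x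
    have : (∃ y : Fin n, y ∈ e ∧ ((x : ℕ), i + (x : ℕ)) = (↑y, i + ↑y)) ↔ x ∈ e := by
      constructor
      · rintro ⟨y, hy, hxy⟩
        have : x = y := Fin.ext (by simpa using congrArg Prod.fst hxy)
        rwa [this]
      · exact fun h => ⟨x, h, rfl⟩
    simp only [hB, this]
  have hset : {ω | ∀ x : Fin n, x ∈ e ↔ ω ∈ marked (x, i + x)} =
      ⋂ x : Fin n, B (x, i + x) := by
    ext ω
    simp only [Set.mem_ofPred_eq, Set.mem_iInter, hBx]
    refine forall_congr' fun x => ?_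
    split_ifs with h <;> simp [h]
  have hmeasA : MeasurableSet[MeasurableSpace.generateFrom {t | ∃ s ∈ S, marked s = t}]
      {ω | ∀ x : Fin n, (rowHeight {s | ω ∈ marked s} i x : ℤ) ≤ a x} := by
    have : {ω | ∀ x : Fin n, (rowHeight {s | ω ∈ marked s} i x : ℤ) ≤ a x} =
        ⋂ x : Fin n, (fun ω => rowHeight {s | ω ∈ marked s} i x) ⁻¹' {k | (k : ℤ) ≤ a x} := by
      ext ω; simp
    rw [this]
    refine MeasurableSet.iInter fun x => ?_
    exact @measurable_rowHeight Ω (MeasurableSpace.generateFrom {t | ∃ s ∈ S, marked s = t})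
      marked i x (fun s hs => MeasurableSpace.measurableSet_generateFrom ⟨s, hs, rfl⟩) _
      (MeasurableSet.of_discrete)
  have hmeasB : MeasurableSet[MeasurableSpace.generateFrom {t | ∃ s ∈ Sᶜ, marked s = t}]
      (⋂ x : Fin n, B (x, i + x)) := by
    refine MeasurableSet.iInter fun x => ?_
    have h1 : MeasurableSet[MeasurableSpace.generateFrom {t | ∃ s ∈ Sᶜ, marked s = t}]
        (marked (x, i + x)) :=
      MeasurableSpace.measurableSet_generateFrom ⟨_, by simp [hS]; omega, rfl⟩
    rw [hBx]
    split_ifs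
    · exact h1
    · exact h1.compl
  have hind := ProbabilityTheory.iIndepSet.indep_generateFrom_of_disjoint hmarked.measurableSet
    hmarked.indep S Sᶜ disjoint_compl_right
  have h1 := (ProbabilityTheory.Indep_iff _ _ _).1 hind _ _ hmeasA hmeasB
  have hinj : Function.Injective fun x : Fin n => ((x : ℕ), i + (x : ℕ)) := by
    intro x y hxy
    exact Fin.ext (by simpa using congrArg Prod.fst hxy)
  have h2 := (ProbabilityTheory.iIndep.precomp hinj
    ((ProbabilityTheory.iIndepSet_iff_iIndep _ _).1 hmarked.indep)).meas_iInter
    (s := fun x : Fin n => B (x, i + x)) (fun x => by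
      have h1 : MeasurableSet[MeasurableSpace.generateFrom {marked (x, i + x)}]
          (marked (x, i + x)) :=
        MeasurableSpace.measurableSet_generateFrom rfl
      rw [hBx]
      split_ifs
      · exact h1
      · exact h1.compl)
  have h3 : ∀ x : Fin n, P.real (B (x, i + x)) = if x ∈ e then p else 1 - p := by
    intro x
    have hm : P.real (marked (x, i + x)) = p := by
      rw [Measure.real, hmarked.prob, ENNReal.toReal_ofReal hp0]
    rw [hBx]
    split_ifs
    · exact hm
    · rw [probReal_compl_eq_one_sub (hmarked.measurableSet _), hm]
  rw [hset, Measure.real, h1, ENNReal.toReal_mul, h2, ENNReal.toReal_prod]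
  congr 1
  exact Finset.prod_congr rfl fun x _ => h3 x

/-- One step of the row process, conditioned on the set `e` of sites that jump by themselves. -/
lemma rowCDF_succ [IsProbabilityMeasure P] (hp0 : 0 ≤ p)
    (hmarked : IsMarking P p marked) (i n : ℕ) {a : Fin n → ℤ} (ha : Monotone a) :
    rowCDF P marked (i + 1) n a = ∑ e : Finset (Fin n), (∏ x, (if x ∈ e then p else 1 - p)) *
      rowCDF P marked i n (fun x => a x - if x ∈ e then 1 else 0) := by
  classical
  set E : Set Ω := {ω | ∀ x : Fin n, (rowHeight {s | ω ∈ marked s} (i + 1) x : ℤ) ≤ a x} with hE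
  set B : Finset (Fin n) → Set Ω := fun e => {ω | ∀ x : Fin n, x ∈ e ↔ ω ∈ marked (x, i + x)}
    with hB
  have hBm : ∀ e, MeasurableSet (B e) := by
    intro e
    have : B e = ⋂ x : Fin n, {ω | x ∈ e ↔ ω ∈ marked (x, i + x)} := by ext; simp [hB]
    rw [this]
    refine MeasurableSet.iInter fun x => ?_
    by_cases hx : x ∈ e
    · simpa [hx] using hmarked.measurableSet _
    · have hc : {ω | x ∈ e ↔ ω ∈ marked (x, i + x)} = (marked (x, i + x))ᶜ := by ext; simp [hx]
      rw [hc]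
      exact (hmarked.measurableSet _).compl
  have hEm : MeasurableSet E := by
    have : E = ⋂ x : Fin n,
        (fun ω => rowHeight {s | ω ∈ marked s} (i + 1) x) ⁻¹' {k | (k : ℤ) ≤ a x} := by
      ext ω; simp [hE]
    rw [this]
    exact MeasurableSet.iInter fun x =>
      measurable_rowHeight _ _ (fun s _ => hmarked.measurableSet s) (MeasurableSet.of_discrete)
  have hcover : E = ⋃ e : Finset (Fin n), E ∩ B e := by
    ext ω
    simp only [Set.mem_iUnion, Set.mem_inter_iff, exists_and_left, iff_self_and]
    intro _
    exact ⟨Finset.univ.filter fun x : Fin n => ω ∈ marked (x, i + x), by simp [hB]⟩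
  have hdisj : Pairwise (Function.onFun Disjoint fun e => E ∩ B e) := by
    intro e e' hne
    refine Set.disjoint_left.2 fun ω h h' => hne ?_
    ext x
    rw [h.2 x, h'.2 x]
  have hterm : ∀ e, E ∩ B e =
      {ω | ∀ x : Fin n, (rowHeight {s | ω ∈ marked s} i x : ℤ) ≤ a x - if x ∈ e then 1 else 0} ∩
        B e := by
    intro e
    ext ω
    simp only [hE, Set.mem_inter_iff, Set.mem_ofPred_eq, and_congr_left_iff,
      forall_rowHeight_succ_le_iff _ _ ha]
    intro hω
    refine forall_congr' fun x => ?_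
    have : (rowMark {s | ω ∈ marked s} i x : ℤ) = if x ∈ e then 1 else 0 := by
      simp [rowMark, hω x]
    rw [this]
    constructor <;> intro h <;> linarith
  calc rowCDF P marked (i + 1) n a = P.real E := rfl
    _ = ∑ e, P.real (E ∩ B e) := by
      conv_lhs => rw [hcover]
      exact measureReal_iUnion_fintype hdisj fun e => hEm.inter (hBm e)
    _ = _ := by
      refine Finset.sum_congr rfl fun e _ => ?_
      rw [hterm, mul_comm]
      exact measure_rowHeight_inter_marks hp0 hmarked i n _ e

end

/-! ### Coefficients of power series at integer indices -/

section

variable {K : Type*} [CommRing K]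

open PowerSeries

/-- The coefficient of a power series at an integer index, zero at the negative ones. -/
def coeffZ (F : PowerSeries K) (k : ℤ) : K := if 0 ≤ k then coeff k.toNat F else 0

lemma coeffZ_of_neg (F : PowerSeries K) {k : ℤ} (hk : k < 0) : coeffZ F k = 0 :=
  if_neg (by omega)

@[simp] lemma coeffZ_natCast (F : PowerSeries K) (k : ℕ) : coeffZ F k = coeff k F := by
  simp [coeffZ]

lemma coeffZ_add (F G : PowerSeries K) (k : ℤ) : coeffZ (F + G) k = coeffZ F k + coeffZ G k := by
  unfold coeffZ; split_ifs <;> simp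

lemma coeffZ_sum (s : Finset ℕ) (f : ℕ → PowerSeries K) (k : ℤ) :
    coeffZ (∑ j ∈ s, f j) k = ∑ j ∈ s, coeffZ (f j) k := by
  unfold coeffZ; split_ifs <;> simp

lemma coeffZ_C_mul (c : K) (F : PowerSeries K) (k : ℤ) : coeffZ (C c * F) k = c * coeffZ F k := by
  unfold coeffZ; split_ifs <;> simp

lemma coeffZ_X_mul (F : PowerSeries K) (k : ℤ) : coeffZ (X * F) k = coeffZ F (k - 1) := by
  rcases lt_trichotomy k 0 with hk | rfl | hk
  · rw [coeffZ_of_neg _ hk, coeffZ_of_neg _ (by omega)]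
  · rw [coeffZ_of_neg _ (show (0 : ℤ) - 1 < 0 by norm_num)]
    simp [coeffZ]
  · obtain ⟨j, rfl⟩ : ∃ j : ℕ, k = j + 1 := ⟨(k - 1).toNat, by omega⟩
    have : ((j : ℤ) + 1) = ((j + 1 : ℕ) : ℤ) := by push_cast; ring
    rw [add_sub_cancel_right, coeffZ_natCast, this, coeffZ_natCast, coeff_succ_X_mul]

lemma coeffZ_one_sub_X_mul (F : PowerSeries K) (k : ℤ) :
    coeffZ ((1 - X) * F) k = coeffZ F k - coeffZ F (k - 1) := by
  have h : F = (1 - X) * F + X * F := by ring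
  have := congrArg (coeffZ · k) h
  simp only [coeffZ_add, coeffZ_X_mul] at this
  rw [this]; ring

lemma coeffZ_X_pow_mul (F : PowerSeries K) (j : ℕ) (k : ℤ) :
    coeffZ (X ^ j * F) k = coeffZ F (k - j) := by
  induction j generalizing k with
  | zero => simp
  | succ j ih =>
    rw [pow_succ', mul_assoc, coeffZ_X_mul, ih]
    congr 1; push_cast; ring

/-- Multiplication by a polynomial as a finite combination of shifts. -/
lemma coeffZ_polynomial_mul (Q : Polynomial K) {N : ℕ} (hQ : Q.natDegree < N) (F : PowerSeries K)
    (k : ℤ) : coeffZ ((Q : PowerSeries K) * F) k =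
      ∑ j ∈ Finset.range N, Q.coeff j * coeffZ F (k - j) := by
  have h1 : (Q : PowerSeries K) = ∑ j ∈ Finset.range N, C (Q.coeff j) * X ^ j := by
    conv_lhs => rw [Q.as_sum_range' N hQ]
    rw [← Polynomial.coeToPowerSeries.ringHom_apply, map_sum]
    refine Finset.sum_congr rfl fun j _ => ?_
    rw [Polynomial.coeToPowerSeries.ringHom_apply, Polynomial.coe_monomial]
    ext k
    simp [coeff_monomial, coeff_C_mul, coeff_X_pow]
  rw [h1, Finset.sum_mul, coeffZ_sum]
  refine Finset.sum_congr rfl fun j _ => ?_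
  rw [mul_assoc, coeffZ_C_mul, coeffZ_X_pow_mul]

/-- The geometric series `1 / (1 - X)`. -/
def geom (K : Type*) [CommRing K] : PowerSeries K := PowerSeries.mk 1

lemma one_sub_X_mul_geom : (1 - X) * geom K = 1 := by
  rw [mul_comm]; exact mk_one_mul_one_sub_eq_one K

lemma one_sub_X_pow_mul_geom_pow {j k : ℕ} (h : k ≤ j) :
    (1 - X) ^ j * geom K ^ k = (1 - X) ^ (j - k) := by
  obtain ⟨i, rfl⟩ := Nat.exists_eq_add_of_le h
  rw [pow_add, mul_right_comm, ← mul_pow, one_sub_X_mul_geom, Nat.add_sub_cancel_left]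
  simp

end

/-! ### The determinantal form of the joint distribution function -/

section

variable {K : Type*} [CommRing K]

open PowerSeries

/-- The generating function of the law of a single mark. -/
def markSeries (p : K) : PowerSeries K := C (1 - p) + C p * X

/-- The determinant `det ([z^(a_x)] (1 - p + p z)^i (1 - z)^(x-y-1) z^(y-x))` of Laurent
coefficients, `x, y < n`. The power of `z` is absorbed into the index of the coefficient, and the
negative powers of `1 - z` are powers of the geometric series. -/
def rowDet (p : K) (i n : ℕ) (a : Fin n → ℤ) : K :=
  (Matrix.of fun x y : Fin n =>
    coeffZ (markSeries p ^ i * (1 - X) ^ (x : ℕ) * geom K ^ (y + 1 : ℕ)) (a x + x - y)).det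

/-- Each row of the matrix satisfies the recursion of a single free site, and the determinant is
multilinear in the rows. -/
lemma rowDet_succ (p : K) (i n : ℕ) (a : Fin n → ℤ) :
    rowDet p (i + 1) n a = ∑ e : Finset (Fin n), (∏ x, (if x ∈ e then p else 1 - p)) *
      rowDet p i n (fun x => a x - if x ∈ e then 1 else 0) := by
  set R : Fin n → ℤ → Fin n → K := fun x k y =>
    coeffZ (markSeries p ^ i * (1 - X) ^ (x : ℕ) * geom K ^ (y + 1 : ℕ)) (k + x - y) with hR
  have h : (Matrix.of fun x y : Fin n =>
      coeffZ (markSeries p ^ (i + 1) * (1 - X) ^ (x : ℕ) * geom K ^ (y + 1 : ℕ)) (a x + x - y)) =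
      (fun x => p • R x (a x - 1)) + fun x => (1 - p) • R x (a x) := by
    funext x y
    simp only [Matrix.of_apply, hR, Pi.add_apply, Pi.smul_apply, smul_eq_mul]
    have e1 : markSeries p ^ (i + 1) * (1 - X) ^ (x : ℕ) * geom K ^ (y + 1 : ℕ) =
        C (1 - p) * (markSeries p ^ i * (1 - X) ^ (x : ℕ) * geom K ^ (y + 1 : ℕ)) +
        C p * (X * (markSeries p ^ i * (1 - X) ^ (x : ℕ) * geom K ^ (y + 1 : ℕ))) := by
      rw [pow_succ']
      nth_rewrite 1 [markSeries]
      ring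
    rw [e1, coeffZ_add, coeffZ_C_mul, coeffZ_C_mul, coeffZ_X_mul, add_comm,
      show a x + (x : ℤ) - y - 1 = a x - 1 + x - y by ring]
  rw [rowDet, h]
  have h2 := (Matrix.detRowAlternating (R := K) (n := Fin n)).map_add_univ
    (fun x => p • R x (a x - 1)) (fun x => (1 - p) • R x (a x))
  refine h2.trans (Finset.sum_congr rfl fun e _ => ?_)
  have h3 : e.piecewise (fun x => p • R x (a x - 1)) (fun x => (1 - p) • R x (a x)) =
      fun x => (if x ∈ e then p else 1 - p) • R x (a x - if x ∈ e then 1 else 0) := by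
    funext x
    by_cases hx : x ∈ e <;> simp [hx]
  rw [h3, AlternatingMap.map_smul_univ]
  rfl

/-- If `a_{x+1} = a_x - 1`, then `a_x` can be lowered by one: the difference of the two
determinants has two equal rows. -/
lemma rowDet_update (p : K) (i n : ℕ) (a : Fin n → ℤ) {x x' : Fin n} (hx : (x' : ℕ) = x + 1)
    (ha : a x' = a x - 1) :
    rowDet p i n (Function.update a x (a x - 1)) = rowDet p i n a := by
  set R : (Fin n → ℤ) → Matrix (Fin n) (Fin n) K := fun a => Matrix.of fun x y : Fin n =>
    coeffZ (markSeries p ^ i * (1 - X) ^ (x : ℕ) * geom K ^ (y + 1 : ℕ)) (a x + x - y) with hR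
  have hne : x' ≠ x := fun h => by rw [h] at hx; omega
  have h1 : R (Function.update a x (a x - 1)) =
      (R a).updateRow x (R (Function.update a x (a x - 1)) x) := by
    ext u v
    by_cases hu : u = x
    · subst hu; simp
    · simp [hu, hR]
  have h2 : R a x = R (Function.update a x (a x - 1)) x + R a x' := by
    funext y
    have e1 : markSeries p ^ i * (1 - X) ^ (x' : ℕ) * geom K ^ (y + 1 : ℕ) =
        (1 - X) * (markSeries p ^ i * (1 - X) ^ (x : ℕ) * geom K ^ (y + 1 : ℕ)) := by
      rw [hx]; ring
    simp only [hR, Matrix.of_apply, Pi.add_apply, Function.update_self]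
    rw [e1, coeffZ_one_sub_X_mul, ha, hx]
    have e2 : a x - 1 + ((x : ℕ) + 1 : ℕ) - (y : ℤ) = a x + x - y := by push_cast; ring
    have e3 : a x + (x : ℤ) - y - 1 = a x - 1 + x - y := by ring
    rw [e2, e3]; ring
  change (R _).det = (R a).det
  have h3 : R a = (R a).updateRow x (R (Function.update a x (a x - 1)) x + R a x') := by
    rw [← h2, Matrix.updateRow_eq_self]
  rw [h3, Matrix.det_updateRow_add, ← h1]
  have h4 : ((R a).updateRow x (R a x')).det = 0 :=
    Matrix.det_updateRow_eq_zero hne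
  rw [h4, add_zero]

/-- For nonnegative arguments the matrix in row zero is upper unitriangular. -/
lemma rowDet_zero_of_nonneg (p : K) (n : ℕ) {a : Fin n → ℤ} (ha : ∀ x, 0 ≤ a x) :
    rowDet p 0 n a = 1 := by
  rw [rowDet, Matrix.det_of_isUpperTriangular]
  · refine Finset.prod_eq_one fun x _ => ?_
    have h : (1 - X) ^ (x : ℕ) * geom K ^ (x + 1 : ℕ) = geom K := by
      rw [pow_succ, ← mul_assoc, ← mul_pow, one_sub_X_mul_geom, one_pow, one_mul]
    obtain ⟨k, hk⟩ := Int.eq_ofNat_of_zero_le (ha x)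
    simp only [Matrix.of_apply, pow_zero, one_mul, h, hk, add_sub_cancel_right]
    simp [geom]
  · intro x y hxy
    have hyx : y < x := hxy
    have hlt : (y : ℕ) + 1 ≤ x := hyx
    simp only [Matrix.of_apply, pow_zero, one_mul]
    rw [one_sub_X_pow_mul_geom_pow hlt]
    obtain ⟨k, hk⟩ := Int.eq_ofNat_of_zero_le (show 0 ≤ a x + x - y by have := ha x; omega)
    have hdeg : ((1 - Polynomial.X : Polynomial K) ^ ((x : ℕ) - (y + 1))).natDegree ≤
        (x : ℕ) - (y + 1) := by
      refine (Polynomial.natDegree_pow_le).trans ?_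
      have : (1 - Polynomial.X : Polynomial K).natDegree ≤ 1 := by
        refine (Polynomial.natDegree_sub_le _ _).trans ?_
        simp [Polynomial.natDegree_X_le]
      nlinarith
    have hcoe : ((1 - X : PowerSeries K) ^ ((x : ℕ) - (y + 1))) =
        (((1 - Polynomial.X : Polynomial K) ^ ((x : ℕ) - (y + 1)) : Polynomial K) :
          PowerSeries K) := by
      simp
    have := ha x
    rw [hk, coeffZ_natCast, hcoe, Polynomial.coeff_coe]
    exact Polynomial.coeff_eq_zero_of_natDegree_lt (by omega)

lemma rowDet_zero_of_neg (p : K) (n : ℕ) {a : Fin n → ℤ} (hn : 0 < n) (ha : a ⟨0, hn⟩ < 0) :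
    rowDet p 0 n a = 0 := by
  refine Matrix.det_eq_zero_of_row_eq_zero ⟨0, hn⟩ fun y => ?_
  simp only [Matrix.of_apply]
  exact coeffZ_of_neg _ (by push_cast; omega)

end

section

variable {Ω : Type*} [MeasurableSpace Ω] {P : Measure Ω} {marked : ℕ × ℕ → Set Ω} {p : ℝ}

/-- The heights are ordered, so that the joint distribution function has the boundary property
of `rowDet_update`. -/
lemma rowCDF_update (i n : ℕ) (a : Fin n → ℤ) {x x' : Fin n} (hx : (x' : ℕ) = x + 1)
    (ha : a x' = a x - 1) :
    rowCDF P marked i n (Function.update a x (a x - 1)) = rowCDF P marked i n a := by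
  refine rowCDF_congr P marked fun s => ?_
  constructor
  · intro h y
    have := h y
    by_cases hy : y = x
    · subst hy; simp at this; omega
    · simpa [hy] using this
  · intro h y
    by_cases hy : y = x
    · subst hy
      have h1 := h x'
      have h2 := rowHeight_le_succ s i y
      rw [← hx] at h2
      simp; omega
    · simpa [hy] using h y

lemma rowCDF_zero [IsProbabilityMeasure P] (n : ℕ) {a : Fin n → ℤ} (ha : Monotone a) :
    ((rowCDF P marked 0 n a : ℝ) : ℂ) = rowDet (p : ℂ) 0 n a := by
  by_cases h : ∀ x, 0 ≤ a x
  · rw [rowDet_zero_of_nonneg _ _ h]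
    simp [rowCDF, rowHeight, h]
  · push Not at h
    obtain ⟨x, hx⟩ := h
    have hn : 0 < n := x.pos
    have h0 : a ⟨0, hn⟩ < 0 := (ha (Fin.mk_le_of_le_val (Nat.zero_le _))).trans_lt hx
    rw [rowDet_zero_of_neg _ _ hn h0]
    have : {ω : Ω | ∀ x : Fin n, (rowHeight {s | ω ∈ marked s} 0 x : ℤ) ≤ a x} = ∅ := by
      ext ω
      simp only [Set.mem_ofPred_eq, Set.mem_empty_iff_false, iff_false, not_forall]
      exact ⟨x, by simp [rowHeight, hx]⟩
    rw [rowCDF, this]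
    simp

/-- Two functions with the boundary property that agree at monotone arguments also agree at the
arguments `a - 1_e` with `a` monotone: the set `e` can be enlarged until `a - 1_e` is monotone. -/
lemma eq_sub_indicator_of_boundary {n : ℕ} {f g : (Fin n → ℤ) → ℂ}
    (hf : ∀ (a : Fin n → ℤ) (x x' : Fin n), (x' : ℕ) = x + 1 → a x' = a x - 1 →
      f (Function.update a x (a x - 1)) = f a)
    (hg : ∀ (a : Fin n → ℤ) (x x' : Fin n), (x' : ℕ) = x + 1 → a x' = a x - 1 →
      g (Function.update a x (a x - 1)) = g a)
    (h : ∀ a, Monotone a → f a = g a) {a : Fin n → ℤ} (ha : Monotone a) (e : Finset (Fin n)) :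
    f (fun x => a x - if x ∈ e then 1 else 0) = g (fun x => a x - if x ∈ e then 1 else 0) := by
  induction hk : eᶜ.card generalizing e with
  | zero =>
    have he : e = Finset.univ := by simpa using hk
    subst he
    refine h _ fun x y hxy => ?_
    have := ha hxy
    simpa using this
  | succ k ih =>
    by_cases hmono : Monotone fun x => a x - if x ∈ e then 1 else 0
    · exact h _ hmono
    · obtain ⟨x, x', hx, hlt⟩ : ∃ x x' : Fin n, (x' : ℕ) = x + 1 ∧
          (a x' - if x' ∈ e then 1 else 0) < a x - if x ∈ e then 1 else 0 := by
        by_contra! hcon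
        apply hmono
        rcases n with _ | n
        · intro x; exact x.elim0
        · exact Fin.monotone_iff_le_succ.2 fun j => hcon j.castSucc j.succ (by simp)
      have hle : a x ≤ a x' := ha (by rw [Fin.le_def]; omega)
      have hxe : x ∉ e := by
        intro hxe; simp only [hxe, if_true] at hlt; split_ifs at hlt <;> omega
      have hxe' : x' ∈ e := by
        by_contra hxe'; simp only [hxe, hxe', if_false] at hlt; omega
      simp only [hxe, hxe', if_true, if_false] at hlt
      have hupd : (fun y => a y - if y ∈ insert x e then 1 else 0) =
          Function.update (fun y => a y - if y ∈ e then 1 else 0) x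
            ((fun y => a y - if y ∈ e then 1 else 0) x - 1) := by
        funext y
        by_cases hy : y = x
        · subst hy; simp [hxe]
        · simp [hy]
      have hcard : (insert x e)ᶜ.card = k := by
        rw [Finset.card_compl, Finset.card_insert_of_notMem hxe]
        rw [Finset.card_compl] at hk
        omega
      have := ih (insert x e) hcard
      have hval : (fun y => a y - if y ∈ e then 1 else 0) x' =
          (fun y => a y - if y ∈ e then 1 else 0) x - 1 := by
        simp only [hxe, hxe', if_true, if_false]; omega
      rwa [hupd, hf _ x x' hx hval, hg _ x x' hx hval] at this

/-- Both sides satisfy the same recursion in `i` on monotone arguments, once the arguments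
`a - 1_e` that it produces are made monotone by the boundary property. -/
theorem rowCDF_eq_rowDet [IsProbabilityMeasure P] (hp0 : 0 ≤ p)
    (hmarked : IsMarking P p marked) (i n : ℕ) {a : Fin n → ℤ} (ha : Monotone a) :
    ((rowCDF P marked i n a : ℝ) : ℂ) = rowDet (p : ℂ) i n a := by
  induction i generalizing a with
  | zero => exact rowCDF_zero n ha
  | succ i ih =>
    rw [rowCDF_succ hp0 hmarked i n ha, rowDet_succ]
    push_cast
    refine Finset.sum_congr rfl fun e _ => ?_
    congr 1
    · refine Finset.prod_congr rfl fun x _ => ?_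
      split_ifs <;> simp
    · exact eq_sub_indicator_of_boundary (f := fun a => ((rowCDF P marked i n a : ℝ) : ℂ))
        (fun a x x' hx h => by rw [rowCDF_update i n a hx h])
        (fun a x x' hx h => rowDet_update _ i n a hx h) (fun a ha => ih ha) ha e

end

/-! ### Reduction to a Toeplitz determinant of size `n` -/

section

variable {K : Type*} [CommRing K]

open PowerSeries

/-- The series `(1 + r X)^m (1 - X)^(-n)`. -/
def dualSeries (r : K) (m n : ℕ) : PowerSeries K := (1 + C r * X) ^ m * geom K ^ n

lemma coeffZ_one_sub_X_pow_mul (F : PowerSeries K) (x : ℕ) (k : ℤ) :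
    coeffZ ((1 - X) ^ x * F) (k + x) =
      ∑ j ∈ Finset.range (x + 1), (x.choose j * (-1) ^ (x - j) : K) * coeffZ F (k + j) := by
  have h1 : (1 - X : PowerSeries K) ^ x = ∑ j ∈ Finset.range (x + 1),
      C (x.choose j * (-1) ^ (x - j) : K) * X ^ (x - j) := by
    rw [sub_eq_add_neg, add_pow]
    refine Finset.sum_congr rfl fun j _ => ?_
    rw [map_mul, map_pow, map_neg, map_one, map_natCast, neg_pow]
    ring
  rw [h1, Finset.sum_mul, coeffZ_sum]
  refine Finset.sum_congr rfl fun j hj => ?_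
  have hjx : j ≤ x := Nat.lt_succ_iff.1 (Finset.mem_range.1 hj)
  rw [mul_assoc, coeffZ_C_mul, coeffZ_X_pow_mul, Nat.cast_sub hjx]
  congr 2; ring

/-- Unitriangular row and column operations turn the determinant for constant bounds into a
Toeplitz determinant. -/
lemma rowDet_const {p r : K} (hr : p = (1 - p) * r) (m n : ℕ) (h : ℤ) :
    rowDet p m n (fun _ => h) = (1 - p) ^ (m * n) *
      (Matrix.of fun x y : Fin n => coeffZ (dualSeries r m n) (h + x - y)).det := by
  set G : PowerSeries K := markSeries p ^ m * geom K ^ n with hG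
  -- `L` expands the row factor `(1 - z)^x z^(-x) = (z⁻¹ - 1)^x` in powers of `z⁻¹`, and `U` expands
  -- the column factor `z^y (1 - z)^(-y-1) = (1 - z)^(-n) z^y (1 - z)^(n-1-y)` in powers of `z`.
  set L : Matrix (Fin n) (Fin n) K := Matrix.of fun x x' =>
    ((x : ℕ).choose x' * (-1) ^ ((x : ℕ) - x') : K) with hL
  set T : Matrix (Fin n) (Fin n) K := Matrix.of fun x y => coeffZ G (h + x - y) with hT
  set Q : ℕ → Polynomial K := fun y => Polynomial.X ^ y * (1 - Polynomial.X) ^ (n - 1 - y) with hQ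
  set U : Matrix (Fin n) (Fin n) K := Matrix.of fun y' y => (Q y).coeff y' with hU
  have hQdeg : ∀ y : Fin n, (Q y).natDegree < n := by
    intro y
    have h1 : (1 - Polynomial.X : Polynomial K).natDegree ≤ 1 := by
      refine (Polynomial.natDegree_sub_le _ _).trans ?_
      simp [Polynomial.natDegree_X_le]
    have h2 : (Q y).natDegree ≤ y + (n - 1 - y) * 1 :=
      Polynomial.natDegree_mul_le.trans (add_le_add (Polynomial.natDegree_X_pow_le _)
        (Polynomial.natDegree_pow_le.trans (Nat.mul_le_mul_left _ h1)))
    have := y.2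
    omega
  have hfac : (Matrix.of fun x y : Fin n => coeffZ (markSeries p ^ m * (1 - X) ^ (x : ℕ) *
      geom K ^ (y + 1 : ℕ)) (h + x - y)) = L * (T * U) := by
    ext x y
    have hyn := y.2
    have e1 : coeffZ (markSeries p ^ m * (1 - X) ^ (x : ℕ) * geom K ^ (y + 1 : ℕ)) (h + x - y) =
        coeffZ ((1 - X) ^ (x : ℕ) * ((Q y : PowerSeries K) * G)) (h + x) := by
      rw [← coeffZ_X_pow_mul]
      congr 1
      have h1 : geom K ^ (y + 1 : ℕ) = (1 - X) ^ (n - 1 - y) * geom K ^ n := by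
        obtain ⟨j, hj⟩ : ∃ j, n = j + (y + 1) := ⟨n - 1 - y, by omega⟩
        rw [show n - 1 - y = j by omega, show geom K ^ n = geom K ^ j * geom K ^ (y + 1 : ℕ) by
          rw [← pow_add, ← hj], ← mul_assoc, ← mul_pow, one_sub_X_mul_geom, one_pow, one_mul]
      rw [h1, hG, hQ]
      push_cast
      ring
    have e2 : ∀ x' : ℕ, coeffZ ((Q y : PowerSeries K) * G) (h + x') =
        ∑ y' : Fin n, coeffZ G (h + x' - y') * U y' y := by
      intro x'
      rw [coeffZ_polynomial_mul _ (hQdeg y), Finset.sum_range]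
      refine Finset.sum_congr rfl fun y' _ => ?_
      rw [mul_comm]; rfl
    rw [Matrix.of_apply, e1, coeffZ_one_sub_X_pow_mul, Matrix.mul_apply,
      Finset.sum_subset (Finset.range_subset_range.2 (show (x : ℕ) + 1 ≤ n from x.2)),
      Finset.sum_range]
    · refine Finset.sum_congr rfl fun x' _ => ?_
      rw [e2, Matrix.mul_apply]; rfl
    · intro j _ hj
      rw [Nat.choose_eq_zero_of_lt (by simpa using hj)]
      simp
  have hLdet : L.det = 1 := by
    rw [Matrix.det_of_isLowerTriangular]
    · exact Finset.prod_eq_one fun x _ => by simp [hL]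
    · intro x x' hx
      have : (x : ℕ) < x' := hx
      simp [hL, Nat.choose_eq_zero_of_lt this]
  have hUdet : U.det = 1 := by
    rw [Matrix.det_of_isLowerTriangular]
    · refine Finset.prod_eq_one fun x _ => ?_
      simp [hU, hQ, Polynomial.coeff_X_pow_mul', Polynomial.coeff_zero_eq_eval_zero]
    · intro x x' hx
      have : (x : ℕ) < x' := hx
      have h' : ¬ x' ≤ x := not_le.2 this
      simp [hU, hQ, Polynomial.coeff_X_pow_mul', h']
  have hGr : G = C ((1 - p) ^ m) * dualSeries r m n := by
    have : markSeries p = C (1 - p) * (1 + C r * X) := by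
      rw [markSeries, mul_add, mul_one, ← mul_assoc, ← map_mul, ← hr]
    rw [hG, this, dualSeries, mul_pow, map_pow]
    ring
  have hTdet : T = (1 - p) ^ m •
      (Matrix.of fun x y : Fin n => coeffZ (dualSeries r m n) (h + x - y)) := by
    ext x y
    simp only [hT, hGr, Matrix.of_apply, coeffZ_C_mul, Matrix.smul_apply, smul_eq_mul]
  rw [rowDet, hfac, Matrix.det_mul, Matrix.det_mul, hLdet, hUdet, hTdet, Matrix.det_smul,
    Fintype.card_fin, ← pow_mul]
  ring

/-! ### Complementary minors -/

/-- Jacobi's identity for complementary minors of a matrix and its inverse. -/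
lemma det_toBlocks₁₁_of_mul_eq_one {ι κ : Type*} [Fintype ι] [DecidableEq ι] [Fintype κ]
    [DecidableEq κ] {A A' : Matrix (ι ⊕ κ) (ι ⊕ κ) K} (h : A * A' = 1) :
    A.toBlocks₁₁.det = A.det * A'.toBlocks₂₂.det := by
  have h1 := h
  rw [← Matrix.fromBlocks_toBlocks A, ← Matrix.fromBlocks_toBlocks A', Matrix.fromBlocks_multiply,
    ← Matrix.fromBlocks_one, Matrix.fromBlocks_inj] at h1
  have h2 : A * Matrix.fromBlocks 1 A'.toBlocks₁₂ 0 A'.toBlocks₂₂ =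
      Matrix.fromBlocks A.toBlocks₁₁ 0 A.toBlocks₂₁ 1 := by
    conv_lhs => rw [← Matrix.fromBlocks_toBlocks A]
    rw [Matrix.fromBlocks_multiply]
    simp [h1.2.1, h1.2.2.2]
  have h3 := congrArg Matrix.det h2
  rw [Matrix.det_mul, Matrix.det_fromBlocks_zero₂₁, Matrix.det_fromBlocks_zero₁₂] at h3
  simpa using h3.symm

lemma finRotate_pow_val (N k : ℕ) (i : Fin N) : (((finRotate N) ^ k) i : ℕ) = (i + k) % N := by
  induction k with
  | zero => simp [Nat.mod_eq_of_lt i.2]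
  | succ k ih =>
    have := i.neZero
    rw [pow_succ', Equiv.Perm.mul_apply, finRotate_apply, Fin.val_add, ih]
    simp [Nat.add_mod, ← add_assoc]

lemma sign_finRotate_pow (h n : ℕ) :
    Equiv.Perm.sign ((finRotate (h + n)) ^ n) = (-1) ^ (n * h) := by
  rw [map_pow, sign_finRotate, ← pow_mul]
  rcases n with _ | n
  · simp
  · have : (h + (n + 1) - 1) * (n + 1) = (n + 1) * h + n * (n + 1) := by
      rw [show h + (n + 1) - 1 = h + n by omega]; ring
    rw [this, pow_add, (Nat.even_mul_succ_self n).neg_one_pow, mul_one]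

/-- Duality of Toeplitz minors: a rectangular minor of the upper triangular Toeplitz matrix of a
power series is, up to sign, a minor of the Toeplitz matrix of the inverse series. -/
lemma det_toeplitz_dual {e F : PowerSeries K} (heF : e * F = 1) (he : coeff 0 e = 1) (h n : ℕ) :
    (Matrix.of fun i j : Fin h => coeffZ e (n + j - i)).det =
      (-1) ^ (n * h) * (Matrix.of fun i j : Fin n => coeffZ F (h + j - i)).det := by
  set T : PowerSeries K → Matrix (Fin (h + n)) (Fin (h + n)) K := fun G =>
    Matrix.of fun i j => coeffZ G (j - i) with hT
  have hmul : T e * T F = 1 := by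
    ext i k
    rw [Matrix.mul_apply]
    simp only [hT, Matrix.of_apply]
    rcases lt_or_ge k i with hki | hik
    · rw [Matrix.one_apply_ne hki.ne']
      refine Finset.sum_eq_zero fun j _ => ?_
      rcases lt_or_ge j i with hj | hj
      · rw [coeffZ_of_neg _ (by omega), zero_mul]
      · rw [coeffZ_of_neg F (by omega), mul_zero]
    · obtain ⟨d, hd⟩ := Nat.exists_eq_add_of_le (show (i : ℕ) ≤ k from hik)
      have h1 : ∑ j : Fin (h + n), coeffZ e ((j : ℤ) - i) * coeffZ F ((k : ℤ) - j) =
          ∑ s ∈ Finset.range (d + 1), coeff s e * coeff (d - s) F := by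
        rw [Fin.sum_univ_eq_sum_range
          (fun j : ℕ => coeffZ e ((j : ℤ) - i) * coeffZ F ((k : ℤ) - j)),
          ← Finset.sum_subset (s₁ := Finset.Ico (i : ℕ) (k + 1)), Finset.sum_Ico_eq_sum_range]
        · rw [show (k : ℕ) + 1 - i = d + 1 by omega]
          refine Finset.sum_congr rfl fun s hs => ?_
          have hs' := Finset.mem_range.1 hs
          rw [show (((i : ℕ) + s : ℕ) : ℤ) - i = (s : ℕ) by push_cast; ring,
            show ((k : ℕ) : ℤ) - ((i : ℕ) + s : ℕ) = (d - s : ℕ) by omega,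
            coeffZ_natCast, coeffZ_natCast]
        · intro j hj
          have := Finset.mem_Ico.1 hj
          exact Finset.mem_range.2 (by omega)
        · intro j _ hj
          rw [Finset.mem_Ico, not_and_or] at hj
          rcases hj with hj | hj
          · rw [coeffZ_of_neg _ (by omega), zero_mul]
          · rw [coeffZ_of_neg F (by omega), mul_zero]
      rw [h1, ← Finset.Nat.sum_antidiagonal_eq_sum_range_succ
        (fun s s' => coeff s e * coeff s' F), ← coeff_mul, heF, coeff_one, Matrix.one_apply]
      congr 1
      simp only [Fin.ext_iff, eq_iff_iff]
      omega
  have hdet : (T e).det = 1 := by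
    rw [Matrix.det_of_isUpperTriangular]
    · refine Finset.prod_eq_one fun x _ => ?_
      have := coeffZ_natCast e 0
      simp only [hT, Matrix.of_apply, sub_self]
      simpa [he] using this
    · intro x y hxy
      have : (y : ℕ) < x := hxy
      exact coeffZ_of_neg _ (by omega)
  -- The rotation by `n` moves the columns of the minor to the front; its sign is `(-1)^(n h)`.
  set σ : Equiv.Perm (Fin (h + n)) := (finRotate (h + n)) ^ n with hσ
  set ε : Fin h ⊕ Fin n ≃ Fin (h + n) := finSumFinEquiv with hε
  have hA : (T e).submatrix ε (ε.trans σ) * (T F).submatrix (ε.trans σ) ε = 1 := by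
    rw [Matrix.submatrix_mul_equiv, hmul]
    simp
  have hJ := det_toBlocks₁₁_of_mul_eq_one hA
  have hl : ∀ i : Fin h, ((σ (ε (Sum.inl i)) : Fin (h + n)) : ℕ) = n + i := by
    intro i
    rw [hσ, finRotate_pow_val]
    simp only [hε, finSumFinEquiv_apply_left, Fin.val_castAdd]
    rw [Nat.mod_eq_of_lt (by omega), add_comm]
  have hr : ∀ i : Fin n, ((σ (ε (Sum.inr i)) : Fin (h + n)) : ℕ) = i := by
    intro i
    rw [hσ, finRotate_pow_val]
    simp only [hε, finSumFinEquiv_apply_right, Fin.val_natAdd]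
    rw [show h + (i : ℕ) + n = i + (h + n) by ring, Nat.add_mod_right, Nat.mod_eq_of_lt (by omega)]
  have h11 : ((T e).submatrix ε (ε.trans σ)).toBlocks₁₁ =
      Matrix.of fun i j : Fin h => coeffZ e (n + j - i) := by
    ext i j
    simp only [Matrix.toBlocks₁₁, Matrix.of_apply, Matrix.submatrix_apply, hT,
      Equiv.trans_apply, hl]
    simp [hε]
  have h22 : ((T F).submatrix (ε.trans σ) ε).toBlocks₂₂ =
      Matrix.of fun i j : Fin n => coeffZ F (h + j - i) := by
    ext i j
    simp only [Matrix.toBlocks₂₂, Matrix.of_apply, Matrix.submatrix_apply, hT,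
      Equiv.trans_apply, hr]
    simp [hε]
  have hAdet : ((T e).submatrix ε (ε.trans σ)).det = (-1) ^ (n * h) := by
    have : (T e).submatrix ε (ε.trans σ) = ((T e).submatrix id σ).submatrix ε ε := rfl
    rw [this, Matrix.det_submatrix_equiv_self, Matrix.det_permute', hdet, mul_one, hσ,
      sign_finRotate_pow]
    simp
  rw [h11, h22, hAdet] at hJ
  exact hJ

/-! ### Fredholm expansion of a finite determinant -/

/-- The determinant of `1 + M` as the sum of all principal minors. -/
lemma det_one_add_eq_sum_minors {ι : Type*} [Fintype ι] [DecidableEq ι] (M : Matrix ι ι K) :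
    (1 + M).det = ∑ s : Finset ι, (M.submatrix (Subtype.val : s → ι) Subtype.val).det := by
  rw [add_comm]
  refine ((Matrix.detRowAlternating (R := K) (n := ι)).map_add_univ M.row
    (1 : Matrix ι ι K).row).trans ?_
  exact Finset.sum_congr rfl fun s _ => Matrix.det_piecewise_one_eq_submatrix_det M s

end

/-- An infinite matrix with only finitely many nonzero columns has a finite Fredholm expansion. -/
lemma hasFredholmDet_of_columns_eq_zero {k : ℕ → ℕ → ℂ} {m : ℕ}
    (hk : ∀ i j, m ≤ j → k i j = 0) :
    HasFredholmDet k (1 - Matrix.of fun i j : Fin m => k i j).det := by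
  have hz : ∀ S ∉ (Finset.univ : Finset (Finset (Fin m))).map (Finset.mapEmbedding
      Fin.valEmbedding).toEmbedding,
      (-1 : ℂ) ^ S.card * (Matrix.of fun i j : S => k i j).det = 0 := by
    intro S hS
    obtain ⟨j, hjS, hj⟩ : ∃ j ∈ S, m ≤ j := by
      by_contra! hcon
      apply hS
      simp only [Finset.mem_map, Finset.mem_univ, true_and]
      refine ⟨S.attachFin hcon, ?_⟩
      ext; simp
    have h0 : (Matrix.of fun i j : S => k i j).det = 0 :=
      Matrix.det_eq_zero_of_column_eq_zero (⟨j, hjS⟩ : S) fun i => hk _ _ hj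
    rw [h0, mul_zero]
  have h := hasSum_sum_of_ne_finset_zero (L := SummationFilter.unconditional _) hz
  rw [HasFredholmDet]
  convert h using 1
  rw [Finset.sum_map, sub_eq_add_neg, det_one_add_eq_sum_minors]
  refine Finset.sum_congr rfl fun s _ => ?_
  have hcard : ((Finset.mapEmbedding Fin.valEmbedding).toEmbedding s).card = s.card := by
    simp [Finset.mapEmbedding]
  rw [hcard]
  let e : s ≃ ((Finset.mapEmbedding (Fin.valEmbedding (n := m))).toEmbedding s : Finset ℕ) :=
    s.equivMap Fin.valEmbedding
  rw [← Matrix.det_submatrix_equiv_self e]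
  have : ((-Matrix.of fun i j : Fin m => k i j).submatrix (Subtype.val : s → Fin m) Subtype.val) =
      -((Matrix.of fun i j : ((Finset.mapEmbedding (Fin.valEmbedding (n := m))).toEmbedding s :
        Finset ℕ) => k i j).submatrix e e) := by
    ext i j; rfl
  rw [this, Matrix.det_neg, Fintype.card_coe]

/-! ### Two-sided sequences acted on by Laurent polynomials -/

/-- Convolution of two-sided sequences; one of the two has finite support in all uses. -/
def conv (f q : ℤ → ℂ) (k : ℤ) : ℂ := ∑ᶠ s, f (k - s) * q s

/-- The coefficient sequence of the constant function `1`. -/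
def delta (k : ℤ) : ℂ := if k = 0 then 1 else 0

/-- Multiplication by `(1 + z)^n` on coefficient sequences. -/
def plusAct (n : ℕ) (f : ℤ → ℂ) (k : ℤ) : ℂ :=
  ∑ i ∈ Finset.range (n + 1), (n.choose i : ℂ) * f (k - i)

/-- Multiplication by `(1 - r / z)^m` on coefficient sequences. -/
def minusAct (m : ℕ) (r : ℂ) (f : ℤ → ℂ) (k : ℤ) : ℂ :=
  ∑ i ∈ Finset.range (m + 1), (m.choose i * (-r) ^ i : ℂ) * f (k + i)

lemma conv_comm (f q : ℤ → ℂ) : conv f q = conv q f := by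
  funext k
  unfold conv
  rw [← finsum_comp_equiv (Equiv.subLeft k)]
  exact finsum_congr fun s => by simp [mul_comm]

lemma conv_sum (f : ℤ → ℂ) (N : ℕ) (w : ℕ → ℂ) (q : ℕ → ℤ → ℂ)
    (hq : ∀ i, (Function.support (q i)).Finite) (k : ℤ) :
    conv f (fun s => ∑ i ∈ Finset.range N, w i * q i s) k =
      ∑ i ∈ Finset.range N, w i * conv f (q i) k := by
  unfold conv
  simp_rw [Finset.mul_sum]
  have hfin : ∀ i, (Function.support fun s => f (k - s) * q i s).Finite := fun i =>
    (hq i).subset fun s hs h => hs (by simp [h])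
  rw [finsum_sum_comm]
  · refine Finset.sum_congr rfl fun i _ => ?_
    rw [mul_finsum]
    exact finsum_congr fun s => by ring
  · intro i _
    exact (hfin i).subset fun s hs h => hs (by
      change f (k - s) * q i s = 0 at h
      change f (k - s) * (w i * q i s) = 0
      rw [mul_left_comm, h, mul_zero])

lemma conv_shift (f q : ℤ → ℂ) (j k : ℤ) : conv f (fun s => q (s - j)) k = conv f q (k - j) := by
  unfold conv
  rw [← finsum_comp_equiv (Equiv.addRight j)]
  refine finsum_congr fun s => ?_
  simp only [Equiv.coe_addRight, add_sub_cancel_right]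
  congr 2; ring

lemma support_shift_finite {q : ℤ → ℂ} (hq : (Function.support q).Finite) (j : ℤ) :
    (Function.support fun s => q (s - j)).Finite :=
  hq.preimage ((Equiv.subRight j).injective.injOn)

lemma conv_plusAct (f : ℤ → ℂ) {q : ℤ → ℂ} (hq : (Function.support q).Finite) (n : ℕ) :
    conv f (plusAct n q) = plusAct n (conv f q) := by
  funext k
  have := conv_sum f (n + 1) (fun i => (n.choose i : ℂ)) (fun i s => q (s - i))
    (fun i => support_shift_finite hq i) k
  simp only [conv_shift] at this
  exact this

lemma conv_minusAct (f : ℤ → ℂ) {q : ℤ → ℂ} (hq : (Function.support q).Finite) (m : ℕ) (r : ℂ) :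
    conv f (minusAct m r q) = minusAct m r (conv f q) := by
  funext k
  have := conv_sum f (m + 1) (fun i => (m.choose i * (-r) ^ i : ℂ)) (fun i s => q (s - (-i : ℤ)))
    (fun i => support_shift_finite hq _) k
  simp only [conv_shift] at this
  simp only [sub_neg_eq_add] at this
  exact this

lemma conv_delta (f : ℤ → ℂ) : conv f delta = f := by
  funext k
  unfold conv
  rw [finsum_eq_single _ 0]
  · simp [delta]
  · intro s hs; simp [delta, hs]

lemma support_delta_finite : (Function.support delta).Finite :=
  (Set.finite_singleton (0 : ℤ)).subset fun s hs => by
    by_contra h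
    exact hs (if_neg h)

/-- The coefficient sequence of `(1 + z)^n`. -/
def plusCoeff (n : ℕ) : ℤ → ℂ := plusAct n delta

/-- The coefficient sequence of `(1 - r / z)^m`. -/
def minusCoeff (m : ℕ) (r : ℂ) : ℤ → ℂ := minusAct m r delta

lemma plusCoeff_natCast (n k : ℕ) : plusCoeff n k = n.choose k := by
  unfold plusCoeff plusAct delta
  by_cases hk : k < n + 1
  · rw [Finset.sum_eq_single_of_mem k (Finset.mem_range.2 hk)]
    · simp
    · intro i _ hi
      rw [if_neg (by omega), mul_zero]
  · rw [Nat.choose_eq_zero_of_lt (by omega), Finset.sum_eq_zero]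
    · simp
    · intro i hi
      have := Finset.mem_range.1 hi
      rw [if_neg (by omega), mul_zero]

lemma plusCoeff_of_neg (n : ℕ) {k : ℤ} (hk : k < 0) : plusCoeff n k = 0 := by
  rw [plusCoeff, plusAct]
  refine Finset.sum_eq_zero fun i _ => ?_
  rw [delta, if_neg (by omega), mul_zero]

lemma plusCoeff_of_lt (n : ℕ) {k : ℤ} (hk : n < k) : plusCoeff n k = 0 := by
  rw [plusCoeff, plusAct]
  refine Finset.sum_eq_zero fun i hi => ?_
  have := Finset.mem_range.1 hi
  rw [delta, if_neg (by omega), mul_zero]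

lemma minusCoeff_of_pos (m : ℕ) (r : ℂ) {k : ℤ} (hk : 0 < k) : minusCoeff m r k = 0 := by
  rw [minusCoeff, minusAct]
  refine Finset.sum_eq_zero fun i _ => ?_
  rw [delta, if_neg (by omega), mul_zero]

lemma minusCoeff_of_lt (m : ℕ) (r : ℂ) {k : ℤ} (hk : k < -m) : minusCoeff m r k = 0 := by
  rw [minusCoeff, minusAct]
  refine Finset.sum_eq_zero fun i hi => ?_
  have := Finset.mem_range.1 hi
  rw [delta, if_neg (by omega), mul_zero]

lemma minusCoeff_zero (m : ℕ) (r : ℂ) : minusCoeff m r 0 = 1 := by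
  unfold minusCoeff minusAct delta
  rw [Finset.sum_eq_single_of_mem 0 (by simp)]
  · simp
  · intro i _ hi
    rw [if_neg (by omega), mul_zero]

lemma support_minusCoeff_finite (m : ℕ) (r : ℂ) : (Function.support (minusCoeff m r)).Finite :=
  (Set.finite_Icc (-m : ℤ) 0).subset fun s hs => by
    by_contra h
    rw [Set.mem_Icc, not_and_or, not_le, not_le] at h
    exact hs (h.elim (minusCoeff_of_lt m r) (minusCoeff_of_pos m r))

lemma conv_plusCoeff (f : ℤ → ℂ) (n : ℕ) : conv f (plusCoeff n) = plusAct n f := by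
  rw [plusCoeff, conv_plusAct f support_delta_finite, conv_delta]

lemma conv_minusCoeff (f : ℤ → ℂ) (m : ℕ) (r : ℂ) :
    conv f (minusCoeff m r) = minusAct m r f := by
  rw [minusCoeff, conv_minusAct f support_delta_finite, conv_delta]

/-! ### Contour integrals -/

lemma fourierCoeffOn_congr {c : ℂ} {R : ℝ} (hR : 0 ≤ R) {f g : ℂ → ℂ}
    (h : ∀ z ∈ Metric.sphere c R, f z = g z) (k : ℤ) :
    fourierCoeffOn c R f k = fourierCoeffOn c R g k := by
  unfold fourierCoeffOn
  congr 1
  exact circleIntegral.integral_congr hR fun z hz => by simp only [h z hz]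

section

variable {c : ℂ} {R : ℝ}

lemma radius_pos (h0 : (0 : ℂ) ∈ Metric.ball c R) : 0 < R := Metric.pos_of_mem_ball h0

lemma ne_of_mem_sphere {z w : ℂ} (hw : w ∈ Metric.ball c R) (hz : z ∈ Metric.sphere c R) :
    z ≠ w := by
  rintro rfl
  rw [Metric.mem_ball] at hw
  rw [Metric.mem_sphere] at hz
  exact hw.ne hz

lemma circleIntegrable_mul_zpow (h0 : (0 : ℂ) ∈ Metric.ball c R) {f : ℂ → ℂ}
    (hf : ContinuousOn f (Metric.sphere c R)) (k : ℤ) :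
    CircleIntegrable (fun z => f z * z ^ k) c R := by
  refine ContinuousOn.circleIntegrable (radius_pos h0).le (hf.mul ?_)
  exact continuousOn_id.zpow₀ k fun z hz => Or.inl (ne_of_mem_sphere h0 hz)

/-- Multiplication of the function by a Laurent polynomial. -/
lemma fourierCoeffOn_sum_zpow_mul (h0 : (0 : ℂ) ∈ Metric.ball c R) {f : ℂ → ℂ}
    (hf : ContinuousOn f (Metric.sphere c R)) (N : ℕ) (w : ℕ → ℂ) (e : ℕ → ℤ) (k : ℤ) :
    fourierCoeffOn c R (fun z => (∑ i ∈ Finset.range N, w i * z ^ e i) * f z) k =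
      ∑ i ∈ Finset.range N, w i * fourierCoeffOn c R f (k - e i) := by
  unfold fourierCoeffOn
  have h1 : (∮ z in C(c, R), (∑ i ∈ Finset.range N, w i * z ^ e i) * f z * z ^ (-k - 1)) =
      ∮ z in C(c, R), ∑ i ∈ Finset.range N, w i * (f z * z ^ (-(k - e i) - 1)) := by
    refine circleIntegral.integral_congr (radius_pos h0).le fun z hz => ?_
    have hz0 := ne_of_mem_sphere h0 hz
    simp only [Finset.sum_mul]
    refine Finset.sum_congr rfl fun i _ => ?_
    rw [show -(k - e i) - 1 = e i + (-k - 1) by ring, zpow_add₀ hz0]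
    ring
  rw [h1, circleIntegral.integral_fun_sum, Finset.mul_sum]
  · refine Finset.sum_congr rfl fun i _ => ?_
    rw [circleIntegral.integral_const_mul]
    ring
  · intro i _
    exact (circleIntegrable_mul_zpow h0 hf _).const_mul _

lemma fourierCoeffOn_plus_mul (h0 : (0 : ℂ) ∈ Metric.ball c R) {f : ℂ → ℂ}
    (hf : ContinuousOn f (Metric.sphere c R)) (n : ℕ) :
    fourierCoeffOn c R (fun z => (1 + z) ^ n * f z) = plusAct n (fourierCoeffOn c R f) := by
  funext k
  rw [plusAct, ← fourierCoeffOn_sum_zpow_mul h0 hf]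
  congr 1
  funext z
  congr 1
  rw [add_comm, add_pow]
  exact Finset.sum_congr rfl fun i _ => by simp [mul_comm]

lemma fourierCoeffOn_minus_mul (h0 : (0 : ℂ) ∈ Metric.ball c R) {f : ℂ → ℂ}
    (hf : ContinuousOn f (Metric.sphere c R)) (m : ℕ) (r : ℂ) :
    fourierCoeffOn c R (fun z => (1 - r / z) ^ m * f z) =
      minusAct m r (fourierCoeffOn c R f) := by
  funext k
  have h := fourierCoeffOn_sum_zpow_mul h0 hf (m + 1) (fun i => (m.choose i * (-r) ^ i : ℂ))
    (fun i => -i) k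
  simp only [sub_neg_eq_add] at h
  rw [minusAct, ← h]
  congr 1
  funext z
  congr 1
  rw [sub_eq_add_neg, add_comm, add_pow]
  refine Finset.sum_congr rfl fun i _ => ?_
  rw [one_pow, mul_one, ← neg_div, div_pow, zpow_neg, zpow_natCast]
  ring

lemma two_pi_I_inv_mul : (2 * Real.pi * Complex.I : ℂ)⁻¹ * (2 * Real.pi * Complex.I) = 1 :=
  inv_mul_cancel₀ Complex.two_pi_I_ne_zero

lemma fourierCoeffOn_one (h0 : (0 : ℂ) ∈ Metric.ball c R) :
    fourierCoeffOn c R (fun _ => 1) = delta := by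
  funext k
  unfold fourierCoeffOn delta
  simp only [one_mul]
  split_ifs with hk
  · subst hk
    have := circleIntegral.integral_sub_inv_of_mem_ball h0
    simp only [sub_zero] at this
    simp only [neg_zero, zero_sub, zpow_neg_one, this]
    exact two_pi_I_inv_mul
  · have := circleIntegral.integral_sub_zpow_of_ne (n := -k - 1) (by omega) c 0 R
    simp only [sub_zero] at this
    rw [this, mul_zero]

/-- The integral of `z^u (z - w)^v` for `u + v ≤ -1` over a contour around `w` is a residue at
infinity. -/
lemma circleIntegral_pow_mul_zpow {w : ℂ} (hw : w ∈ Metric.ball c R) (u : ℕ) {v : ℤ}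
    (hv : v ≤ -1 - u) :
    (∮ z in C(c, R), z ^ u * (z - w) ^ v) = if v = -1 - u then 2 * Real.pi * Complex.I else 0 := by
  have hint : ∀ (u : ℕ) (v : ℤ), CircleIntegrable (fun z => z ^ u * (z - w) ^ v) c R := by
    intro u v
    refine ContinuousOn.circleIntegrable (Metric.pos_of_mem_ball hw).le ?_
    refine (continuousOn_id.pow u).mul ((continuousOn_id.sub continuousOn_const).zpow₀ v ?_)
    exact fun z hz => Or.inl (sub_ne_zero.2 (ne_of_mem_sphere hw hz))
  induction u generalizing v with
  | zero =>
    simp only [pow_zero, one_mul, Nat.cast_zero, sub_zero]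
    split_ifs with h
    · subst h
      simpa using circleIntegral.integral_sub_inv_of_mem_ball hw
    · exact circleIntegral.integral_sub_zpow_of_ne h c w R
  | succ u ih =>
    have h1 : (∮ z in C(c, R), z ^ (u + 1) * (z - w) ^ v) =
        ∮ z in C(c, R), (z ^ u * (z - w) ^ (v + 1) + w * (z ^ u * (z - w) ^ v)) := by
      refine circleIntegral.integral_congr (Metric.pos_of_mem_ball hw).le fun z hz => ?_
      have hz0 : z - w ≠ 0 := sub_ne_zero.2 (ne_of_mem_sphere hw hz)
      rw [zpow_add_one₀ hz0]
      ring
    have h2 : CircleIntegrable (fun z => w * (z ^ u * (z - w) ^ v)) c R := (hint u v).const_mul w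
    push_cast at hv
    rw [h1, circleIntegral.integral_add (hint _ _) h2,
      circleIntegral.integral_const_mul, ih (by omega), ih (by omega),
      if_neg (show ¬ v = -1 - (u : ℤ) by omega), mul_zero, add_zero]
    congr 1
    push_cast
    simp only [eq_iff_iff]
    omega

variable {r : ℝ}

lemma one_sub_div_ne_zero (h0 : (0 : ℂ) ∈ Metric.ball c R) (hr : (r : ℂ) ∈ Metric.ball c R) {z : ℂ}
    (hz : z ∈ Metric.sphere c R) : 1 - (r : ℂ) / z ≠ 0 := by
  have h1 := ne_of_mem_sphere h0 hz
  have h2 := ne_of_mem_sphere hr hz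
  intro h
  rw [sub_eq_zero, eq_div_iff h1, one_mul] at h
  exact h2 h

lemma continuousOn_phiMinus (h0 : (0 : ℂ) ∈ Metric.ball c R) (hr : (r : ℂ) ∈ Metric.ball c R)
    (m : ℕ) : ContinuousOn (phiMinus m r) (Metric.sphere c R) := by
  unfold phiMinus
  refine ContinuousOn.inv₀ ((continuousOn_const.sub (continuousOn_const.div continuousOn_id
    fun z hz => ne_of_mem_sphere h0 hz)).pow m) fun z hz => ?_
  exact pow_ne_zero _ (one_sub_div_ne_zero h0 hr hz)

lemma minusAct_phiMinus (h0 : (0 : ℂ) ∈ Metric.ball c R) (hr : (r : ℂ) ∈ Metric.ball c R)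
    (m m' : ℕ) :
    minusAct m' r (fourierCoeffOn c R (phiMinus (m + m') r)) =
      fourierCoeffOn c R (phiMinus m r) := by
  rw [← fourierCoeffOn_minus_mul h0 (continuousOn_phiMinus h0 hr _)]
  funext k
  refine fourierCoeffOn_congr (radius_pos h0).le (fun z hz => ?_) k
  have := one_sub_div_ne_zero h0 hr hz
  rw [phiMinus, phiMinus, pow_add, mul_inv, mul_left_comm,
    mul_inv_cancel₀ (pow_ne_zero _ this), mul_one]

lemma fourierCoeffOn_phiMinus_zero_index (h0 : (0 : ℂ) ∈ Metric.ball c R)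
    (hr : (r : ℂ) ∈ Metric.ball c R) (m : ℕ) : fourierCoeffOn c R (phiMinus m r) 0 = 1 := by
  rcases m with _ | m
  · have : phiMinus 0 r = fun _ => 1 := by funext z; simp [phiMinus]
    rw [this, fourierCoeffOn_one h0]
    simp [delta]
  · unfold fourierCoeffOn
    have h1 : (∮ z in C(c, R), phiMinus (m + 1) r z * z ^ (-(0 : ℤ) - 1)) =
        ∮ z in C(c, R), z ^ m * (z - r) ^ (-1 - (m : ℤ)) := by
      refine circleIntegral.integral_congr (radius_pos h0).le fun z hz => ?_
      have hz0 := ne_of_mem_sphere h0 hz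
      have hzr : z - r ≠ 0 := sub_ne_zero.2 (ne_of_mem_sphere hr hz)
      have e1 : 1 - (r : ℂ) / z = (z - r) / z := by field_simp
      have e2 : (-1 - (m : ℤ)) = -((m + 1 : ℕ) : ℤ) := by push_cast; ring
      simp only [phiMinus]
      rw [e1, e2, zpow_neg, zpow_natCast, neg_zero, zero_sub, zpow_neg_one, div_pow, inv_div,
        pow_succ z]
      field_simp
    rw [h1, circleIntegral_pow_mul_zpow hr m le_rfl, if_pos rfl]
    exact two_pi_I_inv_mul

/-- `φ₋` has no coefficients of positive index: all its singularities are inside the contour and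
`φ₋(∞) = 1`. -/
lemma fourierCoeffOn_phiMinus_of_pos (h0 : (0 : ℂ) ∈ Metric.ball c R)
    (hr : (r : ℂ) ∈ Metric.ball c R) (m : ℕ) {k : ℤ} (hk : 0 < k) :
    fourierCoeffOn c R (phiMinus m r) k = 0 := by
  by_cases hr0 : r = 0
  · have : phiMinus m r = fun _ => 1 := by funext z; simp [phiMinus, hr0]
    rw [this, fourierCoeffOn_one h0, delta, if_neg hk.ne']
  induction m generalizing k with
  | zero =>
    have : phiMinus 0 r = fun _ => 1 := by funext z; simp [phiMinus]
    rw [this, fourierCoeffOn_one h0, delta, if_neg hk.ne']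
  | succ m ih =>
    have hrec : ∀ k : ℤ, r * fourierCoeffOn c R (phiMinus (m + 1) r) (k + 1) =
        fourierCoeffOn c R (phiMinus (m + 1) r) k - fourierCoeffOn c R (phiMinus m r) k := by
      intro k
      rw [← minusAct_phiMinus h0 hr m 1]
      simp [minusAct, Finset.sum_range_succ]
    have hrC : (r : ℂ) ≠ 0 := by exact_mod_cast hr0
    obtain ⟨j, rfl⟩ : ∃ j : ℕ, k = j + 1 := ⟨(k - 1).toNat, by omega⟩
    clear hk
    induction j with
    | zero =>
      have := hrec 0
      rw [fourierCoeffOn_phiMinus_zero_index h0 hr, fourierCoeffOn_phiMinus_zero_index h0 hr,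
        sub_self] at this
      simpa [hrC] using this
    | succ j ihj =>
      have := hrec (j + 1)
      rw [ihj, ih (by omega), sub_self] at this
      push_cast
      simpa [hrC] using this

lemma conv_phiMinus (h0 : (0 : ℂ) ∈ Metric.ball c R) (hr : (r : ℂ) ∈ Metric.ball c R) (m : ℕ) :
    conv (fourierCoeffOn c R (phiMinus m r)) (minusCoeff m r) = delta := by
  have h := minusAct_phiMinus h0 hr 0 m
  rw [zero_add] at h
  rw [conv_minusCoeff, h, ← fourierCoeffOn_one h0]
  congr 1
  funext z; simp [phiMinus]

lemma fourierCoeffOn_symbol (h0 : (0 : ℂ) ∈ Metric.ball c R) (hr : (r : ℂ) ∈ Metric.ball c R)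
    (m n : ℕ) :
    fourierCoeffOn c R (symbol m n r) = plusAct n (fourierCoeffOn c R (phiMinus m r)) := by
  rw [← fourierCoeffOn_plus_mul h0 (continuousOn_phiMinus h0 hr m)]
  rfl

lemma fourierCoeffOn_symbol_of_lt (h0 : (0 : ℂ) ∈ Metric.ball c R)
    (hr : (r : ℂ) ∈ Metric.ball c R) (m n : ℕ) {k : ℤ} (hk : n < k) :
    fourierCoeffOn c R (symbol m n r) k = 0 := by
  rw [fourierCoeffOn_symbol h0 hr, plusAct]
  refine Finset.sum_eq_zero fun i hi => ?_
  have := Finset.mem_range.1 hi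
  rw [fourierCoeffOn_phiMinus_of_pos h0 hr m (by omega), mul_zero]

lemma continuousOn_symbol (h0 : (0 : ℂ) ∈ Metric.ball c R) (hr : (r : ℂ) ∈ Metric.ball c R)
    (m n : ℕ) : ContinuousOn (symbol m n r) (Metric.sphere c R) := by
  unfold symbol phiPlus
  exact (by fun_prop : ContinuousOn (fun z : ℂ => (1 + z) ^ n) _).mul
    (continuousOn_phiMinus h0 hr m)

lemma conv_symbol (h0 : (0 : ℂ) ∈ Metric.ball c R) (hr : (r : ℂ) ∈ Metric.ball c R) (m n : ℕ) :
    conv (fourierCoeffOn c R (symbol m n r)) (minusCoeff m r) = plusCoeff n := by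
  rw [conv_minusCoeff, ← fourierCoeffOn_minus_mul h0 (continuousOn_symbol h0 hr m n), plusCoeff,
    ← fourierCoeffOn_one h0, ← fourierCoeffOn_plus_mul h0 continuousOn_const]
  funext k
  refine fourierCoeffOn_congr (radius_pos h0).le (fun z hz => ?_) k
  have := one_sub_div_ne_zero h0 hr hz
  rw [symbol, phiMinus, phiPlus, mul_left_comm, mul_inv_cancel₀ (pow_ne_zero _ this)]

lemma one_add_ne_zero (h1 : (-1 : ℂ) ∉ Metric.closedBall c R) {z : ℂ}
    (hz : z ∈ Metric.closedBall c R) : 1 + z ≠ 0 := fun h =>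
  h1 (by rwa [neg_eq_of_add_eq_zero_right h])

lemma continuousOn_phiPlus_inv (h1 : (-1 : ℂ) ∉ Metric.closedBall c R) (n : ℕ) :
    ContinuousOn (fun z => (phiPlus n z)⁻¹) (Metric.closedBall c R) := by
  unfold phiPlus
  exact ContinuousOn.inv₀ (by fun_prop) fun z hz => pow_ne_zero _ (one_add_ne_zero h1 hz)

lemma fourierCoeffOn_phiPlus_inv_of_neg (h0 : (0 : ℂ) ∈ Metric.ball c R)
    (h1 : (-1 : ℂ) ∉ Metric.closedBall c R) (n : ℕ) {k : ℤ} (hk : k < 0) :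
    fourierCoeffOn c R (fun z => (phiPlus n z)⁻¹) k = 0 := by
  unfold fourierCoeffOn
  obtain ⟨j, hj⟩ : ∃ j : ℕ, -k - 1 = j := ⟨(-k - 1).toNat, by omega⟩
  rw [hj, Complex.circleIntegral_eq_zero_of_differentiable_on_off_countable (radius_pos h0).le
    Set.countable_empty, mul_zero]
  · exact (continuousOn_phiPlus_inv h1 n).mul (by simp only [zpow_natCast]; fun_prop)
  · intro z hz
    have hz' : phiPlus n z ≠ 0 :=
      pow_ne_zero _ (one_add_ne_zero h1 (Metric.ball_subset_closedBall hz.1))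
    have hd : DifferentiableAt ℂ (phiPlus n) z := by unfold phiPlus; fun_prop
    simp only [zpow_natCast]
    exact (hd.inv hz').mul (by fun_prop)

lemma continuousOn_phiMinus_div (h0 : (0 : ℂ) ∈ Metric.ball c R)
    (hr : (r : ℂ) ∈ Metric.ball c R) (h1 : (-1 : ℂ) ∉ Metric.closedBall c R) (m n : ℕ) :
    ContinuousOn (fun z => phiMinus m r z / phiPlus n z) (Metric.sphere c R) := by
  simp only [div_eq_mul_inv]
  exact (continuousOn_phiMinus h0 hr m).mul
    ((continuousOn_phiPlus_inv h1 n).mono Metric.sphere_subset_closedBall)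

lemma conv_phiMinus_div_minusCoeff (h0 : (0 : ℂ) ∈ Metric.ball c R)
    (hr : (r : ℂ) ∈ Metric.ball c R) (h1 : (-1 : ℂ) ∉ Metric.closedBall c R) (m n : ℕ) :
    conv (fourierCoeffOn c R (fun z => phiMinus m r z / phiPlus n z)) (minusCoeff m r) =
      fourierCoeffOn c R (fun z => (phiPlus n z)⁻¹) := by
  rw [conv_minusCoeff, ← fourierCoeffOn_minus_mul h0 (continuousOn_phiMinus_div h0 hr h1 m n)]
  funext k
  refine fourierCoeffOn_congr (radius_pos h0).le (fun z hz => ?_) k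
  have := one_sub_div_ne_zero h0 hr hz
  rw [phiMinus, ← mul_div_assoc, mul_inv_cancel₀ (pow_ne_zero _ this), one_div]

lemma conv_phiMinus_div_plusCoeff (h0 : (0 : ℂ) ∈ Metric.ball c R)
    (hr : (r : ℂ) ∈ Metric.ball c R) (h1 : (-1 : ℂ) ∉ Metric.closedBall c R) (m n : ℕ) :
    conv (fourierCoeffOn c R (fun z => phiMinus m r z / phiPlus n z)) (plusCoeff n) =
      fourierCoeffOn c R (phiMinus m r) := by
  rw [conv_plusCoeff, ← fourierCoeffOn_plus_mul h0 (continuousOn_phiMinus_div h0 hr h1 m n)]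
  funext k
  refine fourierCoeffOn_congr (radius_pos h0).le (fun z hz => ?_) k
  have := one_add_ne_zero h1 (Metric.sphere_subset_closedBall hz)
  rw [phiPlus, mul_div_cancel₀ _ (pow_ne_zero _ this)]

/-- `φ₊ / φ₋` is a Laurent polynomial, so that any contour around the origin gives its
coefficients. -/
lemma fourierCoeffOn_phiPlus_div (h0 : (0 : ℂ) ∈ Metric.ball c R) (m n : ℕ) :
    fourierCoeffOn c R (fun z => phiPlus n z / phiMinus m r z) =
      conv (minusCoeff m r) (plusCoeff n) := by
  have hc : ContinuousOn (fun z : ℂ => (1 - (r : ℂ) / z) ^ m) (Metric.sphere c R) :=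
    (continuousOn_const.sub (continuousOn_const.div continuousOn_id
      fun z hz => ne_of_mem_sphere h0 hz)).pow m
  have h2 : minusCoeff m r = fourierCoeffOn c R (fun z => (1 - (r : ℂ) / z) ^ m) := by
    rw [minusCoeff, ← fourierCoeffOn_one h0, ← fourierCoeffOn_minus_mul h0 continuousOn_const]
    simp only [mul_one]
  rw [conv_plusCoeff, h2, ← fourierCoeffOn_plus_mul h0 hc]
  simp only [phiPlus, phiMinus, div_inv_eq_mul]

/-- The coefficient sequences of `φ₋ / φ₊` and `φ₊ / φ₋` are inverse to each other. -/
lemma conv_phiMinus_div_phiPlus_div (h0 : (0 : ℂ) ∈ Metric.ball c R)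
    (hr : (r : ℂ) ∈ Metric.ball c R) (h1 : (-1 : ℂ) ∉ Metric.closedBall c R) (m n : ℕ) :
    conv (fourierCoeffOn c R (fun z => phiMinus m r z / phiPlus n z))
      (conv (minusCoeff m r) (plusCoeff n)) = delta := by
  rw [conv_plusCoeff, conv_plusAct _ (support_minusCoeff_finite m r),
    conv_phiMinus_div_minusCoeff h0 hr h1, ← fourierCoeffOn_plus_mul h0
      ((continuousOn_phiPlus_inv h1 n).mono Metric.sphere_subset_closedBall),
    ← fourierCoeffOn_one h0]
  funext k
  refine fourierCoeffOn_congr (radius_pos h0).le (fun z hz => ?_) k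
  have := one_add_ne_zero h1 (Metric.sphere_subset_closedBall hz)
  rw [phiPlus, mul_inv_cancel₀ (pow_ne_zero _ this)]

end

/-! ### Finite Toeplitz matrices and the Borodin–Okounkov identity -/

/-- The rectangular Toeplitz matrix `(f_{i-j})`, `i < M`, `j < N`. -/
def toep (M N : ℕ) (f : ℤ → ℂ) : Matrix (Fin M) (Fin N) ℂ :=
  Matrix.of fun i j => f ((i : ℤ) - j)

lemma toeplitzDet_eq (f : ℤ → ℂ) (h : ℕ) : toeplitzDet f h = (toep h h f).det := rfl

/-- A truncated sum is a full convolution when all omitted terms vanish. -/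
lemma sum_fin_eq_conv {f g : ℤ → ℂ} {j k : ℤ} {N : ℕ}
    (h : ∀ l : ℤ, l < 0 ∨ N ≤ l → f (j - l) * g (l - k) = 0) :
    ∑ l : Fin N, f (j - l) * g (l - k) = conv f g (j - k) := by
  have h1 : conv f g (j - k) = ∑ᶠ l : ℤ, f (j - l) * g (l - k) := by
    unfold conv
    rw [← finsum_comp_equiv (Equiv.subRight k)]
    exact finsum_congr fun l => by simp
  rw [h1, Fin.sum_univ_eq_sum_range (fun l : ℕ => f (j - l) * g (l - k)),
    finsum_eq_sum_of_support_subset (s := (Finset.range N).map Nat.castEmbedding),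
    Finset.sum_map]
  · rfl
  · intro l hl
    by_contra hcon
    apply hl
    apply h
    by_contra! hl'
    apply hcon
    simp only [Finset.coe_map, Nat.castEmbedding_apply, Finset.coe_range, Set.mem_image,
      Set.mem_Iio]
    exact ⟨l.toNat, by omega, by omega⟩

lemma toep_mul_toep {f g : ℤ → ℂ} {L M N : ℕ}
    (h : ∀ (i : Fin L) (k : Fin N) (l : ℤ), l < 0 ∨ M ≤ l → f (i - l) * g (l - k) = 0) :
    toep L M f * toep M N g = toep L N (conv f g) := by
  ext i k
  exact sum_fin_eq_conv (h i k)

lemma toep_delta (N : ℕ) : toep N N delta = 1 := by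
  ext i j
  simp only [toep, delta, Matrix.of_apply, Matrix.one_apply]
  congr 1
  simp only [Fin.ext_iff, eq_iff_iff]
  omega

lemma det_toep_of_lower {q : ℤ → ℂ} (hq : ∀ k < 0, q k = 0) (hq0 : q 0 = 1) (N : ℕ) :
    (toep N N q).det = 1 := by
  rw [Matrix.det_of_isLowerTriangular]
  · exact Finset.prod_eq_one fun x _ => by simp [toep, hq0]
  · intro i j hij
    have : (i : ℕ) < j := hij
    exact hq _ (by omega)

lemma det_toep_of_upper {q : ℤ → ℂ} (hq : ∀ k > 0, q k = 0) (hq0 : q 0 = 1) (N : ℕ) :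
    (toep N N q).det = 1 := by
  rw [Matrix.det_of_isUpperTriangular]
  · exact Finset.prod_eq_one fun x _ => by simp [toep, hq0]
  · intro i j hij
    have : (j : ℕ) < i := hij
    exact hq _ (by omega)

section

variable {a θ q φ : ℤ → ℂ} {m n : ℕ}

/-- The columns with index at least `M` of the product vanish, so that the factor on the right may
be truncated. -/
lemma toep_mul_truncate (hθ : ∀ k > 0, θ k = 0) (hθm : ∀ k < -(m : ℤ), θ k = 0)
    (haθ : ∀ k < 0, conv a θ k = 0) {M L : ℕ} (hM : m ≤ M)
    (Z : Matrix (Fin (M + n)) (Fin L) ℂ) :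
    toep M (M + n) a * toep (M + n) (M + n) θ * Z =
      toep M M a * toep M M θ * Z.submatrix (Fin.castAdd n) id := by
  ext j k
  rw [Matrix.mul_apply, Fin.sum_univ_add, Matrix.mul_apply]
  have h1 : ∀ i : Fin M, (toep M (M + n) a * toep (M + n) (M + n) θ) j (Fin.castAdd n i) =
      (toep M M a * toep M M θ) j i := by
    intro i
    rw [Matrix.mul_apply, Fin.sum_univ_add, Matrix.mul_apply]
    refine (add_eq_left.2 ?_).trans rfl
    refine Finset.sum_eq_zero fun l _ => ?_
    have : toep (M + n) (M + n) θ (Fin.natAdd M l) (Fin.castAdd n i) = 0 :=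
      hθ _ (by simp; omega)
    rw [this, mul_zero]
  have h2 : ∀ i : Fin n,
      (toep M (M + n) a * toep (M + n) (M + n) θ) j (Fin.natAdd M i) = 0 := by
    intro i
    have h := sum_fin_eq_conv (f := a) (g := θ) (j := j) (k := (Fin.natAdd M i : Fin (M + n)))
      (N := M + n) (by
        intro l hl
        have hi := (Fin.natAdd M i).2
        have hi' : M ≤ ((Fin.natAdd M i : Fin (M + n)) : ℕ) := by simp
        rcases hl with hl | hl
        · rw [hθm _ (by omega), mul_zero]
        · rw [hθ _ (by omega), mul_zero])
    refine h.trans (haθ _ ?_)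
    simp; omega
  simp only [h1, h2, zero_mul, Finset.sum_const_zero, add_zero]
  rfl

/-- In the application `a`, `θ`, `q` and `φ` are the coefficients of `φ₋/φ₊`, `1/φ₋`, `φ₊` and
`φ₊φ₋`; then the truncations of `T(φ₋/φ₊) T(1/φ₋)` and of `T(φ) T(1/φ₋)` are inverse to each
other. -/
lemma toep_mul_eq_one (hθ : ∀ k > 0, θ k = 0) (hθm : ∀ k < -(m : ℤ), θ k = 0)
    (hq : ∀ k < 0, q k = 0) (hqn : ∀ k > (n : ℤ), q k = 0) (hφn : ∀ k > (n : ℤ), φ k = 0)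
    (haθ : ∀ k < 0, conv a θ k = 0) (haq : ∀ k > 0, conv a q k = 0)
    (haqθ : conv (conv a q) θ = delta) (hφθ : conv φ θ = q) {M : ℕ} (hM : m ≤ M) :
    (toep M M a * toep M M θ) * (toep M M φ * toep M M θ) = 1 := by
  have h1 := toep_mul_truncate (a := a) (n := n) hθ hθm haθ hM (toep (M + n) M φ * toep M M θ)
  have h2 : (toep (M + n) M φ * toep M M θ).submatrix (Fin.castAdd n) id =
      toep M M φ * toep M M θ := rfl
  rw [h2] at h1
  rw [← h1, Matrix.mul_assoc, ← Matrix.mul_assoc _ _ (toep M M θ),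
    toep_mul_toep (f := θ) (g := φ), conv_comm, hφθ, ← Matrix.mul_assoc, toep_mul_toep,
    toep_mul_toep, haqθ, toep_delta]
  · intro i k l hl
    rcases hl with hl | hl
    · rw [haq _ (by omega), zero_mul]
    · rw [hθ _ (by omega), mul_zero]
  · intro i k l hl
    rcases hl with hl | hl
    · rw [hq _ (by omega), mul_zero]
    · rw [hqn _ (by push_cast at hl; omega), mul_zero]
  · intro i k l hl
    rcases hl with hl | hl
    · rw [hθ _ (by omega), zero_mul]
    · rw [hφn _ (by push_cast at hl; omega), mul_zero]

lemma kernel_add (a b : ℤ → ℂ) (h j k : ℕ) : kernel a b h j k = kernel a b 0 (h + j) (h + k) := by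
  unfold kernel kernelTerm
  refine tsum_congr fun l => ?_
  congr 2 <;> push_cast <;> ring

lemma conv_of_lt (hθm : ∀ k < -(m : ℤ), θ k = 0) (hq : ∀ k < 0, q k = 0) {k : ℤ}
    (hk : k < -(m : ℤ)) : conv θ q k = 0 := by
  unfold conv
  refine finsum_eq_zero_of_forall_eq_zero fun s => ?_
  rcases lt_or_ge s 0 with hs | hs
  · rw [hq _ hs, mul_zero]
  · rw [hθm _ (by omega), zero_mul]

lemma conv_of_gt (hθ : ∀ k > 0, θ k = 0) (hqn : ∀ k > (n : ℤ), q k = 0) {k : ℤ}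
    (hk : (n : ℤ) < k) : conv θ q k = 0 := by
  unfold conv
  refine finsum_eq_zero_of_forall_eq_zero fun s => ?_
  rcases lt_or_ge (n : ℤ) s with hs | hs
  · rw [hqn _ hs, mul_zero]
  · rw [hθ _ (by omega), zero_mul]

lemma kernelTerm_eq_zero {a b : ℤ → ℂ} (hb : ∀ k < -(m : ℤ), b k = 0) {h j k l : ℕ}
    (hl : m < h + k + l + 1) : kernelTerm a b h j k l = 0 := by
  rw [kernelTerm, hb _ (by omega), mul_zero]

/-- `1 - K₀ = T(φ₋/φ₊) T(φ₊/φ₋)`, truncated. -/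
lemma one_sub_kernel_eq (hθ : ∀ k > 0, θ k = 0) (hθm : ∀ k < -(m : ℤ), θ k = 0)
    (hq : ∀ k < 0, q k = 0) (hqn : ∀ k > (n : ℤ), q k = 0)
    (haθ : ∀ k < 0, conv a θ k = 0) (hab : conv a (conv θ q) = delta) {M : ℕ} (hM : m ≤ M) :
    1 - (Matrix.of fun j k : Fin M => kernel a (conv θ q) 0 j k) =
      toep M M a * toep M M θ * toep M M q := by
  have h1 := toep_mul_truncate (a := a) (n := n) hθ hθm haθ hM (toep (M + n) M q)
  have h2 : (toep (M + n) M q).submatrix (Fin.castAdd n) id = toep M M q := rfl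
  rw [h2] at h1
  rw [← h1, Matrix.mul_assoc, toep_mul_toep (f := θ) (g := q)]
  · ext j k
    rw [Matrix.sub_apply, sub_eq_iff_eq_add, ← toep_delta, ← hab]
    have hb := fun k hk => conv_of_lt hθm hq (k := k) hk
    have hb' := fun k hk => conv_of_gt hθ hqn (k := k) hk
    set b := conv θ q
    have h3 : conv a b ((j : ℤ) - k) = ∑' l : ℤ, a (j - l) * b (l - k) := by
      rw [tsum_eq_finsum]
      · unfold conv
        rw [← finsum_comp_equiv (Equiv.subRight (k : ℤ))]
        exact finsum_congr fun l => by simp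
      · refine (Set.finite_Icc (-(m : ℤ)) (M + n)).subset fun l hl => ?_
        by_contra hcon
        rw [Set.mem_Icc, not_and_or, not_le, not_le] at hcon
        apply hl
        rcases hcon with hcon | hcon
        · simp only; rw [hb _ (by omega), mul_zero]
        · simp only; rw [hb' _ (by omega), mul_zero]
    have hz1 : ∀ l ∉ Finset.range (M + n), a ((j : ℤ) - (l : ℕ)) * b ((l : ℕ) - k) = 0 := by
      intro l hl
      have := Finset.mem_range.not.1 hl
      rw [hb' _ (by omega), mul_zero]
    have hz2 : ∀ l ∉ Finset.range m,
        a ((j : ℤ) - -((l : ℤ) + 1)) * b (-((l : ℤ) + 1) - k) = 0 := by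
      intro l hl
      have := Finset.mem_range.not.1 hl
      rw [hb _ (by omega), mul_zero]
    change conv a b ((j : ℤ) - k) = _
    rw [h3, tsum_of_nat_of_neg_add_one (summable_of_ne_finset_zero hz1)
      (summable_of_ne_finset_zero hz2), tsum_eq_sum hz1]
    congr 1
    · exact (Fin.sum_univ_eq_sum_range
        (fun l : ℕ => a ((j : ℤ) - (l : ℕ)) * b ((l : ℕ) - k)) (M + n)).symm
    · simp only [Matrix.of_apply, kernel, kernelTerm]
      refine tsum_congr fun l => ?_
      congr 2 <;> push_cast <;> ring
  · intro i k l hl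
    rcases hl with hl | hl
    · rw [hq _ (by omega), mul_zero]
    · rw [hqn _ (by push_cast at hl; omega), mul_zero]

/-- The Borodin–Okounkov identity, with the constant expressed by a larger Toeplitz determinant. -/
theorem toeplitzDet_mul_det_one_sub_kernel (hθ : ∀ k > 0, θ k = 0)
    (hθm : ∀ k < -(m : ℤ), θ k = 0) (hθ0 : θ 0 = 1) (hq : ∀ k < 0, q k = 0)
    (hqn : ∀ k > (n : ℤ), q k = 0) (hq0 : q 0 = 1) (hφn : ∀ k > (n : ℤ), φ k = 0)
    (haθ : ∀ k < 0, conv a θ k = 0) (haq : ∀ k > 0, conv a q k = 0)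
    (haqθ : conv (conv a q) θ = delta) (hφθ : conv φ θ = q) (hab : conv a (conv θ q) = delta)
    (h : ℕ) :
    toeplitzDet φ (h + m) *
      (1 - Matrix.of fun j k : Fin m => kernel a (conv θ q) h j k).det = toeplitzDet φ h := by
  set M := h + m with hMdef
  have hM : m ≤ M := by omega
  set G := toep M M φ * toep M M θ with hG
  set B : Matrix (Fin M) (Fin M) ℂ :=
    1 - Matrix.of fun j k : Fin M => kernel a (conv θ q) 0 j k with hB
  have hGB : G * B = toep M M q := by
    rw [hB, one_sub_kernel_eq hθ hθm hq hqn haθ hab hM, ← Matrix.mul_assoc,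
      mul_eq_one_comm.1 (toep_mul_eq_one hθ hθm hq hqn hφn haθ haq haqθ hφθ hM), Matrix.one_mul]
  have hGdet : G.det = toeplitzDet φ M := by
    rw [hG, Matrix.det_mul, det_toep_of_upper hθ hθ0, mul_one, toeplitzDet_eq]
  let ε : Fin h ⊕ Fin m ≃ Fin M := finSumFinEquiv
  have hl : ∀ i, ((ε (Sum.inl i) : Fin M) : ℕ) = i := fun i =>
    congrArg Fin.val (finSumFinEquiv_apply_left (n := m) i)
  have hr : ∀ i, ((ε (Sum.inr i) : Fin M) : ℕ) = h + i := fun i =>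
    congrArg Fin.val (finSumFinEquiv_apply_right (m := h) i)
  have hblocks : G.submatrix ε ε * B.submatrix ε ε = (toep M M q).submatrix ε ε := by
    rw [Matrix.submatrix_mul_equiv, hGB]
  have hG11 : (G.submatrix ε ε).toBlocks₁₁ = toep h h φ * toep h h θ := by
    ext i k
    change G (ε (Sum.inl i)) (ε (Sum.inl k)) = _
    rw [hG, Matrix.mul_apply, ← ε.sum_comp, Fintype.sum_sum_type, Matrix.mul_apply]
    have hz : ∀ l : Fin m, toep M M θ (ε (Sum.inr l)) (ε (Sum.inl k)) = 0 := by
      intro l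
      exact hθ _ (by rw [hl, hr]; push_cast; omega)
    simp only [hz, mul_zero, Finset.sum_const_zero, add_zero]
    simp only [toep, Matrix.of_apply, hl]
  have hB22 : (B.submatrix ε ε).toBlocks₂₂ =
      1 - Matrix.of fun j k : Fin m => kernel a (conv θ q) h j k := by
    ext i k
    change B (ε (Sum.inr i)) (ε (Sum.inr k)) = _
    simp only [hB, Matrix.sub_apply, Matrix.of_apply, hr, kernel_add a _ h, Matrix.one_apply,
      ε.apply_eq_iff_eq, Sum.inr.injEq]
  have hq12 : ((toep M M q).submatrix ε ε).toBlocks₁₂ = 0 := by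
    ext i k
    exact hq _ (by rw [hl, hr]; push_cast; omega)
  have hq22 : ((toep M M q).submatrix ε ε).toBlocks₂₂ = toep m m q := by
    ext i k
    simp only [Matrix.toBlocks₂₂, toep, Matrix.of_apply, Matrix.submatrix_apply, hr]
    congr 1; push_cast; ring
  rw [← Matrix.fromBlocks_toBlocks (G.submatrix ε ε),
    ← Matrix.fromBlocks_toBlocks (B.submatrix ε ε), Matrix.fromBlocks_multiply,
    ← Matrix.fromBlocks_toBlocks ((toep M M q).submatrix ε ε), Matrix.fromBlocks_inj, hq12, hq22]
    at hblocks
  have hprod : G.submatrix ε ε *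
      Matrix.fromBlocks 1 (B.submatrix ε ε).toBlocks₁₂ 0 (B.submatrix ε ε).toBlocks₂₂ =
      Matrix.fromBlocks (G.submatrix ε ε).toBlocks₁₁ 0 (G.submatrix ε ε).toBlocks₂₁
        (toep m m q) := by
    conv_lhs => rw [← Matrix.fromBlocks_toBlocks (G.submatrix ε ε)]
    rw [Matrix.fromBlocks_multiply, hblocks.2.1, hblocks.2.2.2]
    simp
  have hdet := congrArg Matrix.det hprod
  rw [Matrix.det_mul, Matrix.det_fromBlocks_zero₂₁, Matrix.det_fromBlocks_zero₁₂,
    Matrix.det_submatrix_equiv_self, Matrix.det_one, one_mul, hGdet, hG11, hB22, Matrix.det_mul,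
    det_toep_of_upper hθ hθ0, det_toep_of_lower hq hq0, mul_one, mul_one] at hdet
  exact hdet

end

/-! ### The distribution function of the height -/

section

open PowerSeries

lemma one_add_C_mul_X_pow (s : ℂ) (N : ℕ) :
    (1 + C s * X : PowerSeries ℂ) ^ N =
      ∑ i ∈ Finset.range (N + 1), C (N.choose i * s ^ i : ℂ) * X ^ i := by
  rw [add_comm, add_pow]
  refine Finset.sum_congr rfl fun i _ => ?_
  rw [map_mul, map_pow, map_natCast, mul_pow]
  ring

/-- The power series `(-u)^n φ(-1/u)` in `u`: the coefficients of `φ`, whose top degree is `n`, read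
downwards from the top and with alternating signs. -/
def topSeries (φ : ℤ → ℂ) (n : ℕ) : PowerSeries ℂ := PowerSeries.mk fun k => (-1) ^ k * φ (n - k)

lemma coeffZ_topSeries {φ : ℤ → ℂ} {n : ℕ} (hφ : ∀ k > (n : ℤ), φ k = 0) (k : ℤ) :
    coeffZ (topSeries φ n) k = (-1) ^ k * φ (n - k) := by
  rcases lt_or_ge k 0 with hk | hk
  · rw [coeffZ_of_neg _ hk, hφ _ (by omega), mul_zero]
  · obtain ⟨j, rfl⟩ := Int.eq_ofNat_of_zero_le hk
    simp [topSeries]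

lemma topSeries_mul_dualSeries {φ : ℤ → ℂ} {m n : ℕ} {r : ℂ} (hφ : ∀ k > (n : ℤ), φ k = 0)
    (h : minusAct m r φ = plusCoeff n) : topSeries φ n * dualSeries r m n = 1 := by
  have h1 : (1 + C r * X) ^ m * topSeries φ n = (1 - X) ^ n := by
    ext k
    have hl : coeffZ ((1 + C r * X) ^ m * topSeries φ n) k = (-1) ^ k * plusCoeff n (n - k) := by
      rw [one_add_C_mul_X_pow, Finset.sum_mul, coeffZ_sum, ← h, minusAct, Finset.mul_sum]
      refine Finset.sum_congr rfl fun i _ => ?_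
      rw [mul_assoc, coeffZ_C_mul, coeffZ_X_pow_mul, coeffZ_topSeries hφ,
        zpow_sub₀ (by norm_num), zpow_natCast, zpow_natCast,
        show (n : ℤ) - ((k : ℤ) - i) = n - k + i by ring, neg_pow r]
      have : ((-1 : ℂ) ^ i)⁻¹ = (-1) ^ i := by rw [← inv_pow]; norm_num
      rw [div_eq_mul_inv, this]
      ring
    rw [coeffZ_natCast] at hl
    rw [hl, show (1 - X : PowerSeries ℂ) = 1 + C (-1) * X by simp [sub_eq_add_neg],
      one_add_C_mul_X_pow, map_sum]
    simp only [coeff_C_mul, coeff_X_pow, mul_ite, mul_one, mul_zero]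
    rw [Finset.sum_ite_eq]
    rcases le_or_gt k n with hk | hk
    · rw [if_pos (Finset.mem_range.2 (by omega)), ← Nat.cast_sub hk, plusCoeff_natCast,
        Nat.choose_symm hk, mul_comm]
    · rw [if_neg (by simpa using hk), plusCoeff_of_neg _ (by omega), mul_zero]
  rw [dualSeries, ← mul_assoc, mul_comm (topSeries φ n), h1, ← mul_pow, one_sub_X_mul_geom,
    one_pow]

/-- The Toeplitz determinant of size `h` of the symbol equals the dual determinant of size `n`. -/
lemma toeplitzDet_eq_det_dualSeries {φ : ℤ → ℂ} {m n : ℕ} {r : ℂ}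
    (hφ : ∀ k > (n : ℤ), φ k = 0) (hφn : φ n = 1) (hφθ : minusAct m r φ = plusCoeff n) (h : ℕ) :
    toeplitzDet φ h =
      (Matrix.of fun i j : Fin n => coeffZ (dualSeries r m n) (h + i - j)).det := by
  have h1 := det_toeplitz_dual (topSeries_mul_dualSeries hφ hφθ) (by simp [topSeries, hφn]) h n
  have h2 : (Matrix.of fun i j : Fin h => coeffZ (topSeries φ n) (n + j - i)).det =
      (-1) ^ (n * h) * toeplitzDet φ h := by
    have e1 : (Matrix.of fun i j : Fin h => coeffZ (topSeries φ n) (n + j - i)) =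
        Matrix.of fun i j : Fin h => (-1 : ℂ) ^ (j : ℕ) *
          (Matrix.of fun i j : Fin h => ((-1 : ℂ) ^ (n + i : ℕ)) *
            (Matrix.of fun i j : Fin h => φ ((i : ℤ) - (j : ℤ))) i j) i j := by
      ext i j
      simp only [Matrix.of_apply]
      rw [coeffZ_topSeries hφ, zpow_sub₀ (by norm_num), zpow_add₀ (by norm_num), zpow_natCast,
        zpow_natCast, zpow_natCast, show (n : ℤ) - (n + j - i) = i - j by ring]
      have : ((-1 : ℂ) ^ (i : ℕ))⁻¹ = (-1) ^ (i : ℕ) := by rw [← inv_pow]; norm_num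
      rw [div_eq_mul_inv, this, pow_add]
      ring
    have e2 : (∏ i : Fin h, (-1 : ℂ) ^ (i : ℕ)) * ∏ i : Fin h, (-1 : ℂ) ^ (n + i : ℕ) =
        (-1) ^ (n * h) := by
      rw [← Finset.prod_mul_distrib, pow_mul]
      have : ∀ i : Fin h, (-1 : ℂ) ^ (i : ℕ) * (-1) ^ (n + i : ℕ) = (-1) ^ n := by
        intro i
        rw [pow_add, mul_left_comm, ← mul_pow]
        norm_num
      simp [this]
    rw [e1, Matrix.det_mul_row, Matrix.det_mul_column, ← mul_assoc, e2]
    rfl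
  rw [h2] at h1
  have h3 := mul_left_cancel₀ (pow_ne_zero _ (by norm_num)) h1
  rw [h3, ← Matrix.det_transpose]
  rfl

end

section

variable {Ω : Type*} [MeasurableSpace Ω] {P : Measure Ω} {marked : ℕ × ℕ → Set Ω} {p : ℝ}

/-- As the heights increase with the site, a bound on `h_t(x)` is a bound on the whole row up
to `x`. -/
lemma heightCDF_eq_rowCDF {x t : ℕ} (hxt : x ≤ t) (h : ℕ) :
    heightCDF P marked t x h = rowCDF P marked (t - x) (x + 1) fun _ => h := by
  unfold heightCDF rowCDF
  congr 1
  ext ω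
  simp only [Set.mem_ofPred_eq, height_eq_rowHeight, hxt, if_true, Nat.cast_le]
  constructor
  · intro hx y
    exact (rowHeight_mono _ _ (Nat.lt_succ_iff.1 y.2)).trans hx
  · intro hx
    exact hx (Fin.last x)

lemma heightCDF_eq_one [IsProbabilityMeasure P] {x t : ℕ} (hxt : x ≤ t) {h : ℕ}
    (hh : t - x ≤ h) : heightCDF P marked t x h = 1 := by
  rw [heightCDF_eq_rowCDF hxt, rowCDF]
  have : {ω : Ω | ∀ y : Fin (x + 1),
      (rowHeight {s | ω ∈ marked s} (t - x) y : ℤ) ≤ (h : ℤ)} = Set.univ := by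
    ext ω
    simp only [Set.mem_ofPred_eq, Set.mem_univ, iff_true, Nat.cast_le]
    exact fun y => (rowHeight_le _ _ _).trans hh
  rw [this]
  simp

/-- The formula by the Toeplitz determinant `D_h(φ)`. Only the top coefficient `φ_n = 1`, the
vanishing of `φ_k` for `k > n` and the relation `(1 - r/z)^m φ = (1 + z)^n` are used of `φ`. -/
theorem heightCDF_eq_toeplitzDet [IsProbabilityMeasure P] (hp0 : 0 ≤ p) (hp1 : p < 1)
    (hmarked : IsMarking P p marked) {x t : ℕ} (hxt : x ≤ t) {r : ℝ} (hr : r = p / (1 - p))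
    {c : ℂ} {R : ℝ} (h0 : (0 : ℂ) ∈ Metric.ball c R) (hrc : (r : ℂ) ∈ Metric.ball c R) (h : ℕ) :
    (heightCDF P marked t x h : ℂ) = (1 - (p : ℂ)) ^ ((t - x) * (x + 1)) *
      toeplitzDet (fourierCoeffOn c R (symbol (t - x) (x + 1) r)) h := by
  have hpr : (p : ℂ) = (1 - p) * r := by
    have : p = (1 - p) * r := by
      rw [hr, mul_div_cancel₀ _ (by linarith)]
    exact_mod_cast this
  have hφ : ∀ k > ((x + 1 : ℕ) : ℤ),
      fourierCoeffOn c R (symbol (t - x) (x + 1) r) k = 0 :=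
    fun k hk => fourierCoeffOn_symbol_of_lt h0 hrc _ _ hk
  have hφθ : minusAct (t - x) r (fourierCoeffOn c R (symbol (t - x) (x + 1) r)) =
      plusCoeff (x + 1) := by
    rw [← conv_minusCoeff, conv_symbol h0 hrc]
  have hφn : fourierCoeffOn c R (symbol (t - x) (x + 1) r) ((x + 1 : ℕ) : ℤ) = 1 := by
    have := congrFun hφθ ((x + 1 : ℕ) : ℤ)
    rw [plusCoeff_natCast, Nat.choose_self, minusAct,
      Finset.sum_eq_single_of_mem 0 (by simp)] at this
    · simpa using this
    · intro i _ hi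
      rw [hφ _ (by omega), mul_zero]
  rw [heightCDF_eq_rowCDF hxt, rowCDF_eq_rowDet hp0 hmarked _ _ monotone_const,
    rowDet_const hpr, toeplitzDet_eq_det_dualSeries hφ hφn hφθ]

end

end ODB

end

theorem mainTheorem2 {Ω : Type*} [MeasurableSpace Ω] (P : Measure Ω) [IsProbabilityMeasure P]
    (p : ℝ) (hp0 : 0 ≤ p) (hp1 : p < 1)
    (marked : ℕ × ℕ → Set Ω) (hmarked : ODB.IsMarking P p marked)
    (x t : ℕ) (hxt : x ≤ t) (h m n : ℕ) (hm : m = t - x) (hn : n = x + 1)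
    (r : ℝ) (hr : r = p / (1 - p)) :
    -- Toeplitz determinant; the contour has `0` and `r` on the inside
    (∀ (c : ℂ) (R : ℝ), 0 ∈ Metric.ball c R → (r : ℂ) ∈ Metric.ball c R →
      (ODB.heightCDF P marked t x h : ℂ) =
        (1 - (p : ℂ)) ^ (m * n) *
          ODB.toeplitzDet (ODB.fourierCoeffOn c R (ODB.symbol m n r)) h) ∧
    -- Fredholm determinant; the contour for `φ₋/φ₊` has `0` and `r` on the inside and `-1` on the
    -- outside, the contour for `φ₊/φ₋` has `0` on the inside
    (∀ (c : ℂ) (R : ℝ), 0 ∈ Metric.ball c R → (r : ℂ) ∈ Metric.ball c R →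
      (-1 : ℂ) ∉ Metric.closedBall c R →
      ∀ (c' : ℂ) (R' : ℝ), 0 ∈ Metric.ball c' R' →
      ∀ a b : ℤ → ℂ,
      a = ODB.fourierCoeffOn c R (fun z => ODB.phiMinus m r z / ODB.phiPlus n z) →
      b = ODB.fourierCoeffOn c' R' (fun z => ODB.phiPlus n z / ODB.phiMinus m r z) →
      (∀ j k : ℕ, Summable (ODB.kernelTerm a b h j k)) ∧
      ODB.HasFredholmDet (ODB.kernel a b h) (ODB.heightCDF P marked t x h : ℂ)) := by
  subst hm hn
  refine ⟨fun c R h0 hrc => ODB.heightCDF_eq_toeplitzDet hp0 hp1 hmarked hxt hr h0 hrc h, ?_⟩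
  intro c R h0 hrc h1 c' R' h0' a b ha hb
  set m := t - x with hm
  set n := x + 1
  rw [ODB.fourierCoeffOn_phiPlus_div h0'] at hb
  have hθ : ∀ k > 0, ODB.minusCoeff m r k = 0 := fun k hk => ODB.minusCoeff_of_pos m r hk
  have hθm : ∀ k < -(m : ℤ), ODB.minusCoeff m r k = 0 := fun k hk => ODB.minusCoeff_of_lt m r hk
  have hq : ∀ k < 0, ODB.plusCoeff n k = 0 := fun k hk => ODB.plusCoeff_of_neg n hk
  have hqn : ∀ k > (n : ℤ), ODB.plusCoeff n k = 0 := fun k hk => ODB.plusCoeff_of_lt n hk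
  have hzero : ∀ j k l : ℕ, m < h + k + l + 1 → ODB.kernelTerm a b h j k l = 0 := fun j k l hl =>
    ODB.kernelTerm_eq_zero (m := m) (fun k hk => by rw [hb, ODB.conv_of_lt hθm hq hk]) hl
  refine ⟨fun j k => summable_of_ne_finset_zero (s := Finset.range m) fun l hl =>
    hzero j k l (by have := Finset.mem_range.not.1 hl; omega), ?_⟩
  have hcol : ∀ j k, m ≤ k → ODB.kernel a b h j k = 0 := by
    intro j k hk
    rw [ODB.kernel, tsum_congr fun l => hzero j k l (by omega), tsum_zero]
  have hBO := ODB.toeplitzDet_mul_det_one_sub_kernel (a := a)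
    (φ := ODB.fourierCoeffOn c R (ODB.symbol m n r)) hθ hθm (ODB.minusCoeff_zero m r) hq hqn
    (by simpa using ODB.plusCoeff_natCast n 0)
    (fun k hk => ODB.fourierCoeffOn_symbol_of_lt h0 hrc m n hk)
    (fun k hk => by
      rw [ha, ODB.conv_phiMinus_div_minusCoeff h0 hrc h1,
        ODB.fourierCoeffOn_phiPlus_inv_of_neg h0 h1 n hk])
    (fun k hk => by
      rw [ha, ODB.conv_phiMinus_div_plusCoeff h0 hrc h1,
        ODB.fourierCoeffOn_phiMinus_of_pos h0 hrc m hk])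
    (by rw [ha, ODB.conv_phiMinus_div_plusCoeff h0 hrc h1, ODB.conv_phiMinus h0 hrc])
    (ODB.conv_symbol h0 hrc m n)
    (by rw [ha, ODB.conv_phiMinus_div_phiPlus_div h0 hrc h1]) h
  rw [← hb] at hBO
  -- At height `h + m ≥ m` the distribution function is `1`, which evaluates the constant.
  have hone := ODB.heightCDF_eq_toeplitzDet hp0 hp1 hmarked hxt hr h0 hrc (h + m)
  rw [ODB.heightCDF_eq_one hxt (by omega)] at hone
  have hval : (ODB.heightCDF P marked t x h : ℂ) =
      (1 - Matrix.of fun j k : Fin m => ODB.kernel a b h j k).det := by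
    rw [ODB.heightCDF_eq_toeplitzDet hp0 hp1 hmarked hxt hr h0 hrc h, ← hBO, ← mul_assoc,
      ← hone]
    simp
  rw [hval]
  exact ODB.hasFredholmDet_of_columns_eq_zero hcol
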